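/- Let $\Omega\subset\mathbb R^2$ be a bounded open set with smooth boundary, containing the origin. Equip the real space $H^1_0(\Omega)$ (the closure of $C_c^\infty(\Omega)$ in the $H^1$ norm) with the inner product $\langle u,v\rangle=\int_\Omega\nabla u\cdot\nabla v\,dx$. Let $D$ be a bowtie with closure contained in $\Omega$: $D=D_1\cup D_2$, where $D_1,D_2$ are connected open sets whose boundaries are smooth except at $0$, and there are $r_0>0$ and $0<\alpha<\pi$ such that $$D_1\cap B_{r_0}=\{(r\cos\theta,r\sin\theta):0<r<r_0,\ -\tfrac{\alpha}{2}<\theta<\tfrac{\alpha}{2}\},$$ $$D_2\cap B_{r_0}=\{(r\cos\theta,r\sin\theta):0<r<r_0,\ \pi-\tfrac{\alpha}{2}<\theta<\pi+\tfrac{\alpha}{2}\},$$ where $B_{r_0}$ is the open disc with center $0$ and radius $r_0$. Let $T_D:H^1_0(\Omega)\to H^1_0(\Omega)$ be the Poincaré variational operator: for $u\in H^1_0(\Omega)$, $T_Du$ is the unique element of $H^1_0(\Omega)$ such that $$\int_\Omega\nabla(T_Du)\cdot\nabla v\,dx=\int_D\nabla u\cdot\nabla v\,dx\qquad\text{for all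 }v\in H^1_0(\Omega).$$ The spectrum $\sigma(T_D)$ is the set of real $\lambda$ such that $\lambda\,\mathrm{Id}-T_D$ has no bounded inverse, and the essential spectrum $\sigma_{\mathrm{ess}}(T_D)$ is $\sigma(T_D)$ with the isolated points of $\sigma(T_D)$ that are eigenvalues of finite multiplicity removed. Then $T_D$ has only essential spectrum, and $$\sigma(T_D)=\sigma_{\mathrm{ess}}(T_D)=[0,1].$$ -/

import Mathlib

open MeasureTheory Set Filter Topology
open scoped ContDiff Gradient InnerProductSpace

noncomputable section

/-- The Euclidean plane `ℝ²`. -/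
abbrev Plane : Type := EuclideanSpace ℝ (Fin 2)

/-! ### The geometry -/

/-- The boundary of the open set `U` is smooth near its boundary point `x`: near `x`, the set `U` is
the strict sublevel set of a smooth function whose derivative at `x` does not vanish. -/
def SmoothBoundaryAt (U : Set Plane) (x : Plane) : Prop :=
  ∃ (V : Set Plane) (ρ : Plane → ℝ), IsOpen V ∧ x ∈ V ∧ ContDiffOn ℝ ∞ ρ V ∧
    fderiv ℝ ρ x ≠ 0 ∧ U ∩ V = {y ∈ V | ρ y < 0}

/-- The hold-all: a bounded open set with smooth boundary, containing the origin. -/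
structure IsHoldAll (Ω : Set Plane) : Prop where
  isOpen : IsOpen Ω
  isBounded : Bornology.IsBounded Ω
  zero_mem : (0 : Plane) ∈ Ω
  smooth : ∀ x ∈ frontier Ω, SmoothBoundaryAt Ω x

/-- The open circular sector with vertex `0`, radius `r₀`, opening angle `α`, whose axis is the
half-line of polar angle `θ₀`. -/
def sector (r₀ α θ₀ : ℝ) : Set Plane :=
  {x | ∃ r θ : ℝ, 0 < r ∧ r < r₀ ∧ θ₀ - α / 2 < θ ∧ θ < θ₀ + α / 2 ∧
    x = !₂[r * Real.cos θ, r * Real.sin θ]}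

/-- One wing of a bowtie: a connected open set whose boundary is smooth except at `0`, and which
coincides in the ball of radius `r₀` about `0` with a sector of opening `α` and axis `θ₀`. -/
structure IsWing (W : Set Plane) (r₀ α θ₀ : ℝ) : Prop where
  isOpen : IsOpen W
  isConnected : IsConnected W
  smooth : ∀ x ∈ frontier W, x ≠ 0 → SmoothBoundaryAt W x
  inter_ball : W ∩ Metric.ball 0 r₀ = sector r₀ α θ₀

/-- `D` is a bowtie of opening `α`: the union of two wings which near `0` are two opposite
sectors of opening `α ∈ (0, π)`. -/
def IsBowtie (D : Set Plane) (α : ℝ) : Prop :=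
  0 < α ∧ α < Real.pi ∧ ∃ (r₀ : ℝ) (D₁ D₂ : Set Plane), 0 < r₀ ∧
    IsWing D₁ r₀ α 0 ∧ IsWing D₂ r₀ α Real.pi ∧ D = D₁ ∪ D₂

/-! ### The space `H¹₀(Ω)` with the inner product `∫_Ω ∇u · ∇v` -/

/-- `L²(Ω)`. -/
abbrev L2Fun (Ω : Set Plane) : Type := Lp ℝ 2 (volume.restrict Ω)

/-- `L²(Ω; ℝ²)`. -/
abbrev L2Vec (Ω : Set Plane) : Type := Lp Plane 2 (volume.restrict Ω)

/-- `φ ∈ C_c^∞(Ω)`. -/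
def IsTestFunction (Ω : Set Plane) (φ : Plane → ℝ) : Prop :=
  ContDiff ℝ ∞ φ ∧ HasCompactSupport φ ∧ tsupport φ ⊆ Ω

/-- The pairs `(φ, ∇φ)` with `φ ∈ C_c^∞(Ω)`, as a subspace of `L²(Ω) × L²(Ω; ℝ²)`. -/
def testPairs (Ω : Set Plane) : Submodule ℝ (L2Fun Ω × L2Vec Ω) where
  carrier := {p | ∃ φ, IsTestFunction Ω φ ∧ p.1 =ᵐ[volume.restrict Ω] φ ∧
    p.2 =ᵐ[volume.restrict Ω] ∇ φ}
  zero_mem' := by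
    refine ⟨fun _ => 0, ⟨contDiff_const, HasCompactSupport.zero, ?_⟩, ?_, ?_⟩
    · simp [tsupport]
    · exact Lp.coeFn_zero _ _ _
    · rw [show ∇ (fun _ : Plane => (0 : ℝ)) = 0 from gradient_fun_const' 0]
      exact Lp.coeFn_zero _ _ _
  add_mem' := by
    rintro p q ⟨φ, ⟨hφ, hφc, hφs⟩, hp1, hp2⟩ ⟨ψ, ⟨hψ, hψc, hψs⟩, hq1, hq2⟩
    refine ⟨φ + ψ, ⟨hφ.add hψ, hφc.add hψc, ?_⟩, ?_, ?_⟩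
    · exact (tsupport_add φ ψ).trans (union_subset hφs hψs)
    · exact (Lp.coeFn_add p.1 q.1).trans (hp1.add hq1)
    · refine (Lp.coeFn_add p.2 q.2).trans ((hp2.add hq2).trans (Eventually.of_forall fun x => ?_))
      have h1 : DifferentiableAt ℝ φ x := hφ.differentiable (by simp) x
      have h2 : DifferentiableAt ℝ ψ x := hψ.differentiable (by simp) x
      simp [gradient, fderiv_add h1 h2]
  smul_mem' := by
    rintro c p ⟨φ, ⟨hφ, hφc, hφs⟩, hp1, hp2⟩
    refine ⟨c • φ, ⟨hφ.const_smul c, hφc.smul_left (f := fun _ => c), ?_⟩, ?_, ?_⟩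
    · exact (tsupport_smul_subset_right (fun _ => c) φ).trans hφs
    · exact (Lp.coeFn_smul c p.1).trans (hp1.const_smul c)
    · refine (Lp.coeFn_smul c p.2).trans
        ((hp2.const_smul c).trans (Eventually.of_forall fun x => ?_))
      have h1 : DifferentiableAt ℝ φ x := hφ.differentiable (by simp) x
      simp [gradient, fderiv_const_smul h1]

/-- `H¹₀(Ω)` for a bounded set `Ω`: the closure of `C_c^∞(Ω)` in the `H¹` norm. An element is
recorded as the pair `(u, ∇u)` of a function `u ∈ L²(Ω)` and its weak gradient `∇u ∈ L²(Ω; ℝ²)`;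
the set of these pairs is the closure of `{(φ, ∇φ) : φ ∈ C_c^∞(Ω)}` in `L²(Ω) × L²(Ω; ℝ²)`.
Boundedness of `Ω` is part of the type because `∫_Ω ∇u · ∇v` is then an inner product. -/
def H10 (Ω : Set Plane) (_hΩ : Bornology.IsBounded Ω) : Type :=
  ↥(testPairs Ω).topologicalClosure

namespace H10

/-- Poincaré's inequality on `C_c^∞(Ω)`. -/
theorem poincare_testPairs {Ω : Set Plane} (hΩ : Bornology.IsBounded Ω) :
    ∃ C : ℝ, 0 ≤ C ∧ ∀ p ∈ testPairs Ω, ‖p.1‖ ≤ C * ‖p.2‖ := by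
  set C₀ : NNReal := eLpNormLESNormFDerivOfLeConst ℝ (volume : Measure Plane) Ω 1 2 with hC₀
  set c : ENNReal := C₀ * (volume Ω) ^ (1 / 2 : ℝ) with hc
  have hctop : c ≠ ⊤ :=
    ENNReal.mul_ne_top ENNReal.coe_ne_top
      (ENNReal.rpow_ne_top_of_nonneg (one_div_nonneg.2 zero_le_two) hΩ.measure_lt_top.ne)
  refine ⟨c.toReal, ENNReal.toReal_nonneg, ?_⟩
  rintro p ⟨φ, ⟨hφ, hφc, hφs⟩, hp1, hp2⟩
  have hφ1 : ContDiff ℝ 1 φ := hφ.of_le (by simp)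
  have hcont : Continuous (∇ φ) :=
    (InnerProductSpace.toDual ℝ Plane).symm.continuous.comp (hφ1.continuous_fderiv (by simp))
  have hsupp : Function.support (∇ φ) ⊆ Ω := by
    refine Subset.trans (fun x hx => ?_) hφs
    refine support_fderiv_subset ℝ (fun h0 : fderiv ℝ φ x = 0 => hx ?_)
    rw [gradient, h0, map_zero]
  have hS : eLpNorm φ 2 volume ≤ C₀ * eLpNorm (∇ φ) 1 volume := by
    refine (eLpNorm_le_eLpNorm_fderiv_of_le (p := 1) (q := 2) volume hφ1
      ((subset_tsupport φ).trans hφs) le_rfl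
      (by rw [finrank_euclideanSpace_fin]; norm_num)
      (by rw [finrank_euclideanSpace_fin]; norm_num) hΩ).trans_eq (congrArg _ ?_)
    exact eLpNorm_congr_norm_ae (Eventually.of_forall fun x =>
      ((InnerProductSpace.toDual ℝ Plane).symm.norm_map (fderiv ℝ φ x)).symm)
  have key : eLpNorm p.1 2 (volume.restrict Ω) ≤ c * eLpNorm p.2 2 (volume.restrict Ω) := by
    rw [eLpNorm_congr_ae hp1, eLpNorm_congr_ae hp2]
    calc eLpNorm φ 2 (volume.restrict Ω)
      _ ≤ eLpNorm φ 2 volume := eLpNorm_mono_measure _ Measure.restrict_le_self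
      _ ≤ C₀ * eLpNorm (∇ φ) 1 volume := hS
      _ = C₀ * eLpNorm (∇ φ) 1 (volume.restrict Ω) := by
          rw [eLpNorm_restrict_eq_of_support_subset hsupp]
      _ ≤ C₀ * (eLpNorm (∇ φ) 2 (volume.restrict Ω) * (volume Ω) ^ (1 / 2 : ℝ)) := by
          gcongr
          refine (eLpNorm_le_eLpNorm_mul_rpow_measure_univ (p := 1) (q := 2) (by norm_num)
            hcont.aestronglyMeasurable).trans_eq ?_
          norm_num
      _ = c * eLpNorm (∇ φ) 2 (volume.restrict Ω) := by rw [hc]; ring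
  rw [Lp.norm_def, Lp.norm_def, ← ENNReal.toReal_mul]
  exact ENNReal.toReal_mono (ENNReal.mul_ne_top hctop (Lp.eLpNorm_ne_top _)) key

variable {Ω : Set Plane} {hΩ : Bornology.IsBounded Ω}

instance : AddCommGroup (H10 Ω hΩ) :=
  inferInstanceAs (AddCommGroup ↥(testPairs Ω).topologicalClosure)

instance : Module ℝ (H10 Ω hΩ) :=
  inferInstanceAs (Module ℝ ↥(testPairs Ω).topologicalClosure)

/-- The underlying function `u ∈ L²(Ω)`, as a linear map. -/
def toL2 : H10 Ω hΩ →ₗ[ℝ] L2Fun Ω :=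
  LinearMap.fst ℝ (L2Fun Ω) (L2Vec Ω) ∘ₗ (testPairs Ω).topologicalClosure.subtype

/-- The weak gradient `∇u ∈ L²(Ω; ℝ²)`, as a linear map. -/
def grad : H10 Ω hΩ →ₗ[ℝ] L2Vec Ω :=
  LinearMap.snd ℝ (L2Fun Ω) (L2Vec Ω) ∘ₗ (testPairs Ω).topologicalClosure.subtype

/-- Poincaré's inequality on `H¹₀(Ω)`. -/
theorem poincare (hΩ : Bornology.IsBounded Ω) :
    ∃ C : ℝ, 0 ≤ C ∧ ∀ u : H10 Ω hΩ, ‖toL2 u‖ ≤ C * ‖grad u‖ := by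
  obtain ⟨C, hC, h⟩ := poincare_testPairs hΩ
  refine ⟨C, hC, fun u => ?_⟩
  have hcl : IsClosed {p : L2Fun Ω × L2Vec Ω | ‖p.1‖ ≤ C * ‖p.2‖} :=
    isClosed_le (by fun_prop) (by fun_prop)
  exact closure_minimal (fun p hp => h p hp) hcl u.2

/-- The inner product `⟨u, v⟩ = ∫_Ω ∇u · ∇v dx`. -/
@[reducible]
def innerCore : InnerProductSpace.Core ℝ (H10 Ω hΩ) where
  inner u v := ∫ x in Ω, ⟪grad u x, grad v x⟫_ℝ
  conj_inner_symm u v := by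
    simp [real_inner_comm]
  re_inner_nonneg u := integral_nonneg fun _ => real_inner_self_nonneg
  add_left u v w := by
    simp only [← L2.inner_def, map_add, inner_add_left]
  smul_left u v c := by
    simp only [← L2.inner_def, map_smul, inner_smul_left]
  definite u hu := by
    rw [← L2.inner_def, inner_self_eq_zero] at hu
    obtain ⟨C, -, hC⟩ := poincare hΩ
    have h1 : toL2 u = 0 := by
      have := hC u
      rw [hu, norm_zero, mul_zero] at this
      exact norm_le_zero_iff.1 this
    exact Subtype.ext (Prod.ext h1 hu)

instance : NormedAddCommGroup (H10 Ω hΩ) := innerCore.toNormedAddCommGroup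

instance : InnerProductSpace ℝ (H10 Ω hΩ) := InnerProductSpace.ofCore innerCore.toCore

theorem inner_eq (u v : H10 Ω hΩ) : ⟪u, v⟫_ℝ = ∫ x in Ω, ⟪grad u x, grad v x⟫_ℝ := rfl

theorem norm_eq (u : H10 Ω hΩ) : ‖u‖ = ‖grad u‖ := by
  rw [norm_eq_sqrt_real_inner u, norm_eq_sqrt_real_inner (grad u), inner_eq, L2.inner_def]

/-- The weak gradient, as an isometry `H¹₀(Ω) → L²(Ω; ℝ²)`. -/
def gradL : H10 Ω hΩ →ₗᵢ[ℝ] L2Vec Ω where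
  toLinearMap := grad
  norm_map' u := (norm_eq u).symm

instance : CompleteSpace (H10 Ω hΩ) := by
  refine Metric.complete_of_cauchySeq_tendsto fun u hu => ?_
  obtain ⟨C, hC0, hC⟩ := poincare hΩ
  have hg : CauchySeq fun n => grad (u n) := gradL.isometry.uniformContinuous.comp_cauchySeq hu
  have hl : Continuous (toL2 : H10 Ω hΩ → L2Fun Ω) :=
    AddMonoidHomClass.continuous_of_bound toL2 C fun v => by rw [norm_eq]; exact hC v
  have hf : CauchySeq fun n => toL2 (u n) :=
    (uniformContinuous_addMonoidHom_of_continuous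
      (f := (toL2 : H10 Ω hΩ →ₗ[ℝ] L2Fun Ω).toAddMonoidHom) hl).comp_cauchySeq hu
  obtain ⟨a, ha⟩ := cauchySeq_tendsto_of_complete hf
  obtain ⟨b, hb⟩ := cauchySeq_tendsto_of_complete hg
  have hab : (a, b) ∈ (testPairs Ω).topologicalClosure :=
    (testPairs Ω).isClosed_topologicalClosure.mem_of_tendsto (ha.prodMk_nhds hb)
      (Eventually.of_forall fun n => (u n).2)
  refine ⟨⟨(a, b), hab⟩, gradL.isometry.isEmbedding.tendsto_nhds_iff.2 hb⟩

end H10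

/-! ### The Poincaré variational operator -/

/-- The restriction to `D` of the weak gradient. -/
def gradOn {Ω : Set Plane} (hΩ : Bornology.IsBounded Ω) (D : Set Plane) :
    H10 Ω hΩ →L[ℝ] Lp Plane 2 ((volume.restrict Ω).restrict D) :=
  LpToLpRestrictCLM Plane Plane ℝ (volume.restrict Ω) 2 D ∘L H10.gradL.toContinuousLinearMap

/-- The Poincaré variational operator `T_D : H¹₀(Ω) → H¹₀(Ω)`, the operator obtained from the
Riesz representation theorem such that `∫_Ω ∇(T_D u) · ∇v = ∫_D ∇u · ∇v` for all `u, v ∈ H¹₀(Ω)`;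
see `poincareOperator_spec` and `poincareOperator_unique`. -/
def poincareOperator {Ω : Set Plane} (hΩ : Bornology.IsBounded Ω) (D : Set Plane) :
    H10 Ω hΩ →L[ℝ] H10 Ω hΩ :=
  (gradOn hΩ D).adjoint ∘L gradOn hΩ D

/-- The defining property of `T_D`. -/
theorem poincareOperator_spec {Ω D : Set Plane} (hΩ : Bornology.IsBounded Ω) (hD : D ⊆ Ω)
    (u v : H10 Ω hΩ) :
    ∫ x in Ω, ⟪(poincareOperator hΩ D u).grad x, v.grad x⟫_ℝ =
      ∫ x in D, ⟪u.grad x, v.grad x⟫_ℝ := by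
  rw [← H10.inner_eq, poincareOperator, ContinuousLinearMap.comp_apply,
    ContinuousLinearMap.adjoint_inner_left, L2.inner_def,
    ← Measure.restrict_restrict_of_subset (μ := volume) hD]
  refine integral_congr_ae ?_
  filter_upwards [LpToLpRestrictCLM_coeFn ℝ D u.grad, LpToLpRestrictCLM_coeFn ℝ D v.grad]
    with x hu hv
  exact congrArg₂ (fun a b : Plane => ⟪a, b⟫_ℝ) hu hv

/-- `T_D u` is the only element of `H¹₀(Ω)` with the defining property. -/
theorem poincareOperator_unique {Ω D : Set Plane} (hΩ : Bornology.IsBounded Ω) (hD : D ⊆ Ω)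
    (u w : H10 Ω hΩ)
    (hw : ∀ v : H10 Ω hΩ, ∫ x in Ω, ⟪w.grad x, v.grad x⟫_ℝ =
      ∫ x in D, ⟪u.grad x, v.grad x⟫_ℝ) :
    w = poincareOperator hΩ D u := by
  refine ext_inner_right ℝ fun v => ?_
  rw [H10.inner_eq, H10.inner_eq, hw v, poincareOperator_spec hΩ hD]

theorem poincareOperator_isSelfAdjoint {Ω : Set Plane} (hΩ : Bornology.IsBounded Ω)
    (D : Set Plane) : IsSelfAdjoint (poincareOperator hΩ D) :=
  (ContinuousLinearMap.isPositive_adjoint_comp_self (gradOn hΩ D)).isSelfAdjoint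

/-! ### The essential spectrum -/

section Spectrum

variable {H : Type*} [NormedAddCommGroup H] [InnerProductSpace ℝ H]

/-- The discrete spectrum of a bounded self-adjoint operator on a real Hilbert space: the isolated
points of the spectrum which are eigenvalues of finite multiplicity. -/
def discreteSpectrum (T : H →L[ℝ] H) : Set ℝ :=
  {l | l ∈ spectrum ℝ T ∧
    (∃ ε > 0, spectrum ℝ T ∩ Ioo (l - ε) (l + ε) = {l}) ∧
    Module.End.HasEigenvalue (T : H →ₗ[ℝ] H) l ∧
    FiniteDimensional ℝ (Module.End.eigenspace (T : H →ₗ[ℝ] H) l)}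

/-- The essential spectrum: the complement of the discrete spectrum in the spectrum. -/
def essentialSpectrum (T : H →L[ℝ] H) : Set ℝ :=
  spectrum ℝ T \ discreteSpectrum T

end Spectrum

end

/-!
The quadratic form of `T_D` lies between `0` and the squared norm, so the spectrum is contained in
`[0, 1]`. Every `l ∈ (0, 1)` with `l ≠ 1/2` is in the spectrum because of the vertex of the
bowtie; the spectrum being closed, it is all of `[0, 1]`, and then it has no isolated point, so
that the discrete spectrum is empty.

To see that `l` is in the spectrum, put `a = l - 1_D`, so that `⟨(l - T_D) u, v⟩ = ∫ a ∇u · ∇v`.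
In polar coordinates near `0`, with `s = log r`, the coefficient `a` depends on the angle only,
and the equation `div (a ∇u) = 0` has solutions `cos (ξ s + θ) Φ`, where `Φ'' = ξ² Φ` on each of
the four sectors and `Φ` and the flux `a Φ'` are continuous. Taking `Φ` odd in one axis of the
bowtie and even in the other one, the transmission condition reads `-p / q = tanh (ξ γ) tanh (ξ
(π/2 - γ))`, where `p` is the value of `a` in the sectors of half-opening `γ` around the points
where `Φ` vanishes, and `q` the value in the two other sectors. The right-hand side takes all
values in `(0, 1)` (`exists_transmission`), which settles `l > 1/2` with one choice of the axis
and `l < 1/2` with the other one.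

Such a solution is cut off by a function `χ` of `log r`, giving a function `u` whose gradient
satisfies `a ∇u = ∇^⊥ w + e` (`norm_sq_smul_gradient_sub_rot`). The conjugate function `w` is
built from the flux `a Φ'`, which is itself a multiple of the profile of the complementary sectors
(`Transmission.angular_conj`). Both `u` and `w` are Lipschitz with compact support, hence belong
to `H¹₀(Ω)` by mollification (`exists_H10_of_lipschitzWith`), and `∇^⊥ w` is orthogonal to all
gradients (`integral_inner_rot_grad`), so that `‖(l - T_D) u‖ ≤ ‖e‖`. Two quasi-modes in
quadrature have total energy at least a multiple of `∫ χ²`, whereas the remainders are bounded by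
`∫ (χ'² + χ''²)`. If `l - T_D` were invertible, the first integral would be bounded by a multiple
of the second one for all `χ` supported near `-∞` (`exists_cutoff_inequality`), which fails for a
bump spread over a long interval (`not_cutoff_inequality`).
-/

open scoped Convolution NNReal ENNReal

/-! ### Lipschitz functions with compact support belong to `H¹₀(Ω)` -/

/-- Bounded convergence in `L²` on a finite measure space. -/
theorem tendsto_eLpNorm_two_of_ae_bounded {X E : Type*} [MeasurableSpace X]
    [NormedAddCommGroup E] {μ : Measure X} [IsFiniteMeasure μ] {f : ℕ → X → E} {g : X → E}
    {C : ℝ} (hf : ∀ n, AEStronglyMeasurable (f n) μ) (hg : AEStronglyMeasurable g μ)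
    (hfC : ∀ n, ∀ᵐ x ∂μ, ‖f n x‖ ≤ C) (hgC : ∀ᵐ x ∂μ, ‖g x‖ ≤ C)
    (hlim : ∀ᵐ x ∂μ, Tendsto (fun n => f n x) atTop (𝓝 (g x))) :
    Tendsto (fun n => eLpNorm (f n - g) 2 μ) atTop (𝓝 0) := by
  have key : Tendsto (fun n => ∫⁻ x, ‖(f n - g) x‖ₑ ^ (2 : ℝ) ∂μ) atTop (𝓝 (∫⁻ _, 0 ∂μ)) := by
    refine tendsto_lintegral_of_dominated_convergence' (fun _ => ENNReal.ofReal (C + C) ^ (2 : ℝ))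
      (fun n => ((hf n).sub hg).enorm.pow_const _) (fun n => ?_) ?_ ?_
    · filter_upwards [hfC n, hgC] with x h1 h2
      gcongr
      rw [← ofReal_norm]
      exact ENNReal.ofReal_le_ofReal ((norm_sub_le _ _).trans (add_le_add h1 h2))
    · rw [lintegral_const]
      exact ENNReal.mul_ne_top (ENNReal.rpow_ne_top_of_nonneg zero_le_two ENNReal.ofReal_ne_top)
        (measure_ne_top _ _)
    · filter_upwards [hlim] with x hx
      have h0 : Tendsto (fun n => ‖(f n - g) x‖ₑ) atTop (𝓝 0) := by
        simpa using (hx.sub_const (g x)).enorm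
      simpa using h0.ennrpow_const (2 : ℝ)
  simp only [lintegral_zero] at key
  have h2 := key.ennrpow_const (1 / 2 : ℝ)
  rw [ENNReal.zero_rpow_of_pos (by norm_num)] at h2
  refine h2.congr fun n => ?_
  rw [eLpNorm_eq_lintegral_rpow_enorm_toReal (by simp) (by simp)]
  simp

section Mollify

variable {f : Plane → ℝ} {C : ℝ≥0}

theorem integrable_normed_smul_sub (φ : ContDiffBump (0 : Plane)) (hf : Continuous f)
    (x : Plane) : Integrable (fun t => φ.normed volume t • f (x - t)) := by
  refine Continuous.integrable_of_hasCompactSupport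
    (φ.continuous_normed.smul (hf.comp (by fun_prop))) ?_
  exact φ.hasCompactSupport_normed.smul_right

theorem normed_convolution_apply (φ : ContDiffBump (0 : Plane)) (f : Plane → ℝ) (x : Plane) :
    (φ.normed volume ⋆[ContinuousLinearMap.lsmul ℝ ℝ, volume] f) x =
      ∫ t, φ.normed volume t • f (x - t) := rfl

theorem norm_normed_convolution_sub_le (φ : ContDiffBump (0 : Plane)) (hf : LipschitzWith C f)
    (x y : Plane) :
    ‖(φ.normed volume ⋆[ContinuousLinearMap.lsmul ℝ ℝ, volume] f) x -
      (φ.normed volume ⋆[ContinuousLinearMap.lsmul ℝ ℝ, volume] f) y‖ ≤ C * ‖x - y‖ := by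
  rw [normed_convolution_apply, normed_convolution_apply,
    ← integral_sub (integrable_normed_smul_sub φ hf.continuous x)
      (integrable_normed_smul_sub φ hf.continuous y)]
  calc _ ≤ ∫ t, φ.normed volume t * (C * ‖x - y‖) := by
        refine norm_integral_le_of_norm_le (φ.integrable_normed.mul_const _)
          (Eventually.of_forall fun t => ?_)
        rw [← smul_sub, norm_smul, Real.norm_of_nonneg (φ.nonneg_normed t)]
        refine mul_le_mul_of_nonneg_left ?_ (φ.nonneg_normed t)
        simpa using hf.norm_sub_le (x - t) (y - t)
    _ = C * ‖x - y‖ := by rw [integral_mul_const, φ.integral_normed, one_mul]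

theorem norm_normed_convolution_le (φ : ContDiffBump (0 : Plane)) {M : ℝ}
    (hM : ∀ x, ‖f x‖ ≤ M) (x : Plane) :
    ‖(φ.normed volume ⋆[ContinuousLinearMap.lsmul ℝ ℝ, volume] f) x‖ ≤ M := by
  rw [normed_convolution_apply]
  calc _ ≤ ∫ t, φ.normed volume t * M := by
        refine norm_integral_le_of_norm_le (φ.integrable_normed.mul_const _)
          (Eventually.of_forall fun t => ?_)
        rw [norm_smul, Real.norm_of_nonneg (φ.nonneg_normed t)]
        exact mul_le_mul_of_nonneg_left (hM _) (φ.nonneg_normed t)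
    _ = M := by rw [integral_mul_const, φ.integral_normed, one_mul]

theorem contDiff_normed_convolution (φ : ContDiffBump (0 : Plane)) (hf : Continuous f) :
    ContDiff ℝ ∞ (φ.normed volume ⋆[ContinuousLinearMap.lsmul ℝ ℝ, volume] f) :=
  φ.hasCompactSupport_normed.contDiff_convolution_left _ φ.contDiff_normed hf.locallyIntegrable

/-- Differentiation commutes with mollification of a Lipschitz function. -/
theorem fderiv_normed_convolution (φ : ContDiffBump (0 : Plane)) (hf : LipschitzWith C f)
    (x v : Plane) :
    fderiv ℝ (φ.normed volume ⋆[ContinuousLinearMap.lsmul ℝ ℝ, volume] f) x v =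
      (φ.normed volume ⋆[ContinuousLinearMap.lsmul ℝ ℝ, volume]
        (fun y => lineDeriv ℝ f y v)) x := by
  have hd : DifferentiableAt ℝ (φ.normed volume ⋆[ContinuousLinearMap.lsmul ℝ ℝ, volume] f) x :=
    (contDiff_normed_convolution φ hf.continuous).differentiable (by simp) x
  have h1 := (hd.hasFDerivAt.hasLineDerivAt v).tendsto_slope_zero_right
  have hint : Integrable (fun y => φ.normed volume (x - y)) :=
    φ.integrable_normed.comp_sub_left x
  have h2 := hf.integral_inv_smul_sub_mul_tendsto_integral_lineDeriv_mul hint v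
  have h3 : (φ.normed volume ⋆[ContinuousLinearMap.lsmul ℝ ℝ, volume]
        (fun y => lineDeriv ℝ f y v)) x = ∫ y, lineDeriv ℝ f y v * φ.normed volume (x - y) := by
    rw [normed_convolution_apply, ← integral_sub_left_eq_self _ volume x]
    simp [mul_comm]
  rw [h3]
  refine tendsto_nhds_unique h1 (h2.congr fun t => ?_)
  rw [normed_convolution_apply, normed_convolution_apply,
    ← integral_sub (integrable_normed_smul_sub φ hf.continuous _)
      (integrable_normed_smul_sub φ hf.continuous x), ← integral_smul,
    ← integral_sub_left_eq_self _ volume x]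
  congr 1
  ext y
  simp only [smul_eq_mul, sub_sub_cancel]
  rw [show x + t • v - y = x - y + t • v by abel]
  ring

end Mollify

/-- The gradient of a function, read in the coordinates of the plane. -/
theorem gradient_apply (f : Plane → ℝ) (x : Plane) (i : Fin 2) :
    (∇ f x) i = fderiv ℝ f x (EuclideanSpace.single i 1) := by
  have h : ⟪∇ f x, EuclideanSpace.single i (1 : ℝ)⟫_ℝ =
      fderiv ℝ f x (EuclideanSpace.single i 1) := by
    rw [gradient, InnerProductSpace.toDual_symm_apply]
  rw [← h, EuclideanSpace.inner_single_right]
  simp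

theorem norm_gradient (f : Plane → ℝ) (x : Plane) : ‖∇ f x‖ = ‖fderiv ℝ f x‖ :=
  (InnerProductSpace.toDual ℝ Plane).symm.norm_map (fderiv ℝ f x)

theorem measurable_gradient (f : Plane → ℝ) : Measurable (∇ f) :=
  (InnerProductSpace.toDual ℝ Plane).symm.continuous.measurable.comp (measurable_fderiv ℝ f)

theorem norm_gradient_le {f : Plane → ℝ} {C : ℝ≥0} (hf : LipschitzWith C f) (x : Plane) :
    ‖∇ f x‖ ≤ C := by
  rw [norm_gradient]
  exact norm_fderiv_le_of_lipschitz ℝ hf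

/-- A Lipschitz function with compact support in `Ω` belongs to `H¹₀(Ω)`, and its weak gradient is
its almost everywhere defined gradient. -/
theorem exists_H10_of_lipschitzWith {Ω : Set Plane} (hΩ : Bornology.IsBounded Ω)
    (hΩo : IsOpen Ω) {f : Plane → ℝ} {C : ℝ≥0} (hf : LipschitzWith C f)
    (hfc : HasCompactSupport f) (hfs : tsupport f ⊆ Ω) :
    ∃ u : H10 Ω hΩ, u.grad =ᵐ[volume.restrict Ω] ∇ f := by
  obtain ⟨δ, hδ, hδΩ⟩ := hfc.isCompact.exists_cthickening_subset_open hΩo hfs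
  obtain ⟨M, hM⟩ := hfc.exists_bound_of_continuous hf.continuous
  have : IsFiniteMeasure (volume.restrict Ω) := ⟨by simpa using hΩ.measure_lt_top⟩
  let φ : ℕ → ContDiffBump (0 : Plane) := fun n =>
    ⟨δ / 2 / (n + 1), δ / (n + 1), by positivity, by gcongr; linarith⟩
  have hφ : Tendsto (fun n => (φ n).rOut) atTop (𝓝 0) :=
    tendsto_const_div_atTop_nhds_zero_nat δ |>.comp (tendsto_add_atTop_nat 1) |>.congr fun n => by
      simp [φ]
  let F : ℕ → Plane → ℝ := fun n =>
    (φ n).normed volume ⋆[ContinuousLinearMap.lsmul ℝ ℝ, volume] f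
  have hFs : ∀ n, ContDiff ℝ ∞ (F n) := fun n => contDiff_normed_convolution _ hf.continuous
  have hFsupp : ∀ n, tsupport (F n) ⊆ Metric.cthickening δ (tsupport f) := fun n => by
    refine closure_minimal ?_ Metric.isClosed_cthickening
    refine (support_convolution_subset_swap _).trans ?_
    rintro x ⟨a, ha, b, hb, rfl⟩
    rw [(φ n).support_normed_eq, mem_ball_zero_iff] at hb
    refine Metric.mem_cthickening_of_dist_le _ a _ _ (subset_tsupport f ha) ?_
    have : δ / ((n : ℝ) + 1) ≤ δ := div_le_self hδ.le (by linarith [n.cast_nonneg (α := ℝ)])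
    simpa [dist_eq_norm] using hb.le.trans this
  have hFt : ∀ n, IsTestFunction Ω (F n) := fun n =>
    ⟨hFs n, HasCompactSupport.of_support_subset_isCompact hfc.isCompact.cthickening
      ((subset_tsupport _).trans (hFsupp n)), (hFsupp n).trans hδΩ⟩
  have hFC : ∀ n, LipschitzWith C (F n) := fun n => LipschitzWith.of_dist_le_mul fun x y => by
    rw [dist_eq_norm, dist_eq_norm]
    exact norm_normed_convolution_sub_le _ hf x y
  have hM1 : MemLp f 2 (volume.restrict Ω) :=
    MemLp.of_bound hf.continuous.aestronglyMeasurable M (Eventually.of_forall hM)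
  have hM2 : MemLp (∇ f) 2 (volume.restrict Ω) :=
    MemLp.of_bound (measurable_gradient f).aestronglyMeasurable C
      (Eventually.of_forall (norm_gradient_le hf))
  have hM1n : ∀ n, MemLp (F n) 2 (volume.restrict Ω) := fun n =>
    MemLp.of_bound (hFs n).continuous.aestronglyMeasurable M
      (Eventually.of_forall (norm_normed_convolution_le _ hM))
  have hM2n : ∀ n, MemLp (∇ (F n)) 2 (volume.restrict Ω) := fun n =>
    MemLp.of_bound (measurable_gradient _).aestronglyMeasurable C
      (Eventually.of_forall (norm_gradient_le (hFC n)))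
  have hlim1 : Tendsto (fun n => (hM1n n).toLp) atTop (𝓝 hM1.toLp) := by
    rw [Lp.tendsto_Lp_iff_tendsto_eLpNorm'']
    refine tendsto_eLpNorm_two_of_ae_bounded (fun n => (hM1n n).1) hM1.1
      (fun n => Eventually.of_forall (norm_normed_convolution_le _ hM))
      (Eventually.of_forall hM) (Eventually.of_forall fun x => ?_)
    exact ContDiffBump.convolution_tendsto_right_of_continuous hφ hf.continuous x
  have hlim2 : Tendsto (fun n => (hM2n n).toLp) atTop (𝓝 hM2.toLp) := by
    rw [Lp.tendsto_Lp_iff_tendsto_eLpNorm'']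
    refine tendsto_eLpNorm_two_of_ae_bounded (fun n => (hM2n n).1) hM2.1
      (fun n => Eventually.of_forall (norm_gradient_le (hFC n)))
      (Eventually.of_forall (norm_gradient_le hf)) ?_
    have hconv : ∀ i : Fin 2, ∀ᵐ x : Plane, Tendsto (fun n =>
        ((φ n).normed volume ⋆[ContinuousLinearMap.lsmul ℝ ℝ, volume]
          (fun y => lineDeriv ℝ f y (EuclideanSpace.single i 1))) x) atTop
          (𝓝 (lineDeriv ℝ f x (EuclideanSpace.single i 1))) := fun i =>
      ContDiffBump.ae_convolution_tendsto_right_of_locallyIntegrable (K := 2) hφ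
        (Eventually.of_forall fun n => le_of_eq (by simp only [φ]; ring))
        (hf.locallyIntegrable_lineDeriv _)
    refine ae_restrict_of_ae ?_
    filter_upwards [ae_all_iff.2 hconv, hf.ae_differentiableAt] with x hx hdx
    refine (PiLp.continuous_toLp 2 (fun _ : Fin 2 => ℝ)).continuousAt.tendsto.comp
      (f := fun n => WithLp.ofLp (∇ (F n) x)) (x := atTop) (y := 𝓝 (WithLp.ofLp (∇ f x))) ?_
    refine tendsto_pi_nhds.2 fun i => ?_
    rw [gradient_apply, ← hdx.lineDeriv_eq_fderiv]
    refine (hx i).congr fun n => ?_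
    rw [gradient_apply, fderiv_normed_convolution _ hf]
  have hmem : (hM1.toLp, hM2.toLp) ∈ (testPairs Ω).topologicalClosure := by
    refine (testPairs Ω).isClosed_topologicalClosure.mem_of_tendsto (hlim1.prodMk_nhds hlim2)
      (Eventually.of_forall fun n => subset_closure ?_)
    exact ⟨F n, hFt n, (hM1n n).coeFn_toLp, (hM2n n).coeFn_toLp⟩
  exact ⟨⟨_, hmem⟩, hM2.coeFn_toLp⟩

/-! ### Rotated gradients are orthogonal to gradients -/

/-- `rot i j w = w j • e_i - w i • e_j`; for `i ≠ j` this is a rotation by a right angle, whose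
orientation depends on the order of `i` and `j`. -/
noncomputable def rot (i j : Fin 2) : Plane →L[ℝ] Plane :=
  (EuclideanSpace.proj j : Plane →L[ℝ] ℝ).smulRight (EuclideanSpace.single i 1) -
    (EuclideanSpace.proj i : Plane →L[ℝ] ℝ).smulRight (EuclideanSpace.single j 1)

theorem inner_rot (i j : Fin 2) (a b : Plane) : ⟪rot i j a, b⟫_ℝ = a j * b i - a i * b j := by
  simp [rot, inner_sub_left, inner_smul_left, EuclideanSpace.inner_single_left]

theorem integral_fderiv_mul_fderiv_comm {φ ψ : Plane → ℝ} (hφ : ContDiff ℝ ∞ φ)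
    (hφc : HasCompactSupport φ) (hψ : ContDiff ℝ ∞ ψ) (v w : Plane) :
    ∫ x, fderiv ℝ φ x v * fderiv ℝ ψ x w = ∫ x, fderiv ℝ φ x w * fderiv ℝ ψ x v := by
  have hd : ∀ {χ : Plane → ℝ}, ContDiff ℝ ∞ χ → ∀ v, ContDiff ℝ ∞ fun x => fderiv ℝ χ x v :=
    fun h v => (h.fderiv_right (m := ∞) (by simp)).clm_apply contDiff_const
  have hint : ∀ {g : Plane → ℝ}, ContDiff ℝ ∞ g → HasCompactSupport g → Integrable g :=
    fun h hc => h.continuous.integrable_of_hasCompactSupport hc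
  have hdiff : ∀ {g : Plane → ℝ}, ContDiff ℝ ∞ g → Differentiable ℝ g :=
    fun h => h.differentiable (by simp)
  have hfc : ∀ v, HasCompactSupport fun x => fderiv ℝ φ x v := fun v => hφc.fderiv_apply ℝ v
  have parts : ∀ v w, ∫ x, φ x * fderiv ℝ (fun y => fderiv ℝ ψ y w) x v =
      - ∫ x, fderiv ℝ φ x v * fderiv ℝ ψ x w := fun v w =>
    integral_mul_fderiv_eq_neg_fderiv_mul_of_integrable
      (hint ((hd hφ v).mul (hd hψ w)) ((hfc v).mul_right))
      (hint (hφ.mul (hd (hd hψ w) v)) hφc.mul_right) (hint (hφ.mul (hd hψ w)) hφc.mul_right)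
      (fun x _ => hdiff hφ x) (fun x _ => hdiff (hd hψ w) x)
  have hsymm : ∀ x, fderiv ℝ (fun y => fderiv ℝ ψ y w) x v =
      fderiv ℝ (fun y => fderiv ℝ ψ y v) x w := fun x => by
    have h2 : DifferentiableAt ℝ (fderiv ℝ ψ) x :=
      (hψ.fderiv_right (m := ∞) (by simp)).differentiable (by simp) x
    have hs : IsSymmSndFDerivAt ℝ ψ x :=
      (contDiff_infty.1 hψ 2).contDiffAt.isSymmSndFDerivAt (by simp)
    rw [fderiv_clm_apply h2 (differentiableAt_const _), fderiv_clm_apply h2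
      (differentiableAt_const _)]
    simpa using hs.eq v w
  rw [← neg_inj, ← parts v w, ← parts w v]
  simp only [hsymm]

theorem integral_inner_rot_gradient_testFunction {Ω : Set Plane} {φ ψ : Plane → ℝ}
    (hφ : IsTestFunction Ω φ) (hψ : IsTestFunction Ω ψ) (i j : Fin 2) :
    ∫ x in Ω, ⟪rot i j (∇ φ x), ∇ ψ x⟫_ℝ = 0 := by
  have hsupp : ∀ x ∉ Ω, ⟪rot i j (∇ φ x), ∇ ψ x⟫_ℝ = 0 := fun x hx => by
    have h0 : fderiv ℝ φ x = 0 := by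
      by_contra h
      exact hx (hφ.2.2 (support_fderiv_subset ℝ h))
    rw [gradient, h0, map_zero, map_zero, inner_zero_left]
  rw [setIntegral_eq_integral_of_forall_compl_eq_zero hsupp]
  simp only [inner_rot, gradient_apply]
  have hint : ∀ v w, Integrable fun x => fderiv ℝ φ x v * fderiv ℝ ψ x w := fun v w =>
    (((hφ.1.continuous_fderiv (by simp)).clm_apply continuous_const).mul
      ((hψ.1.continuous_fderiv (by simp)).clm_apply
        continuous_const)).integrable_of_hasCompactSupport (hφ.2.1.fderiv_apply ℝ v).mul_right
  rw [integral_sub (hint _ _) (hint _ _), sub_eq_zero]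
  exact integral_fderiv_mul_fderiv_comm hφ.1 hφ.2.1 hψ.1 _ _

/-- The rotated gradient of an element of `H¹₀(Ω)` is divergence free, hence orthogonal to all
gradients of elements of `H¹₀(Ω)`. -/
theorem integral_inner_rot_grad {Ω : Set Plane} {hΩ : Bornology.IsBounded Ω} (i j : Fin 2)
    (w v : H10 Ω hΩ) : ∫ x in Ω, ⟪rot i j (w.grad x), v.grad x⟫_ℝ = 0 := by
  have hrew : ∀ a b : L2Vec Ω, ∫ x in Ω, ⟪rot i j (a x), b x⟫_ℝ =
      ⟪(rot i j).compLp a, b⟫_ℝ := fun a b => by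
    rw [L2.inner_def]
    refine integral_congr_ae ?_
    filter_upwards [(rot i j).coeFn_compLp a] with x hx
    rw [hx]
  rw [hrew]
  have hcl : ∀ {s : Set ((L2Fun Ω × L2Vec Ω) × (L2Fun Ω × L2Vec Ω))},
      s = {p | ⟪(rot i j).compLp p.1.2, p.2.2⟫_ℝ = 0} → IsClosed s := by
    rintro _ rfl
    refine isClosed_eq ?_ continuous_const
    exact ((((rot i j).compLpL 2 (volume.restrict Ω)).continuous.comp (by fun_prop)).inner
      (by fun_prop))
  have hsub : (testPairs Ω : Set (L2Fun Ω × L2Vec Ω)) ×ˢ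
      (testPairs Ω : Set (L2Fun Ω × L2Vec Ω)) ⊆
      {p : (L2Fun Ω × L2Vec Ω) × (L2Fun Ω × L2Vec Ω) | ⟪(rot i j).compLp p.1.2, p.2.2⟫_ℝ = 0} := by
    rintro ⟨p, q⟩ ⟨⟨φ, hφ, -, hp⟩, ⟨ψ, hψ, -, hq⟩⟩
    rw [mem_ofPred_eq, ← hrew, ← integral_inner_rot_gradient_testFunction hφ hψ i j]
    refine integral_congr_ae ?_
    filter_upwards [hp, hq] with x h1 h2
    rw [h1, h2]
  have := closure_minimal hsub (hcl rfl)
  rw [closure_prod_eq] at this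
  have hmem : ((w.1, v.1) : (L2Fun Ω × L2Vec Ω) × (L2Fun Ω × L2Vec Ω)) ∈
      closure (testPairs Ω : Set (L2Fun Ω × L2Vec Ω)) ×ˢ
        closure (testPairs Ω : Set (L2Fun Ω × L2Vec Ω)) := ⟨w.2, v.2⟩
  exact this hmem

/-! ### The spectrum of the Poincaré operator -/

theorem poincareOperator_inner_self_nonneg {Ω : Set Plane} (hΩ : Bornology.IsBounded Ω)
    (D : Set Plane) (u : H10 Ω hΩ) : 0 ≤ ⟪poincareOperator hΩ D u, u⟫_ℝ := by
  rw [poincareOperator, ContinuousLinearMap.comp_apply, ContinuousLinearMap.adjoint_inner_left]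
  exact real_inner_self_nonneg

theorem poincareOperator_inner_self_le {Ω D : Set Plane} (hΩ : Bornology.IsBounded Ω)
    (hD : D ⊆ Ω) (u : H10 Ω hΩ) : ⟪poincareOperator hΩ D u, u⟫_ℝ ≤ ‖u‖ ^ 2 := by
  rw [← real_inner_self_eq_norm_sq, H10.inner_eq, H10.inner_eq, poincareOperator_spec hΩ hD]
  exact setIntegral_mono_set (L2.integrable_inner _ _)
    (Eventually.of_forall fun _ => real_inner_self_nonneg) (LE.le.eventuallyLE hD)

/-- A bounded operator with coercive quadratic form is invertible (Lax–Milgram). -/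
theorem isUnit_of_coercive {H : Type*} [NormedAddCommGroup H] [InnerProductSpace ℝ H]
    [CompleteSpace H] (A : H →L[ℝ] H) {c : ℝ} (hc : 0 < c)
    (h : ∀ u, c * ‖u‖ ^ 2 ≤ ⟪A u, u⟫_ℝ) : IsUnit A := by
  have hB : IsCoercive ((innerSL ℝ).comp A) :=
    ⟨c, hc, fun u => by simpa [sq, mul_assoc] using h u⟩
  have : A = (hB.continuousLinearEquivOfBilin : H →L[ℝ] H) := by
    ext v
    refine hB.unique_continuousLinearEquivOfBilin fun w => ?_
    simp
  rw [this]
  exact ⟨hB.continuousLinearEquivOfBilin.toUnit, rfl⟩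

theorem spectrum_poincareOperator_subset {Ω D : Set Plane} (hΩ : Bornology.IsBounded Ω)
    (hD : D ⊆ Ω) : spectrum ℝ (poincareOperator hΩ D) ⊆ Icc 0 1 := by
  intro l hl
  rw [spectrum.mem_iff] at hl
  have hin : ∀ u : H10 Ω hΩ, ⟪(algebraMap ℝ (H10 Ω hΩ →L[ℝ] H10 Ω hΩ) l -
      poincareOperator hΩ D) u, u⟫_ℝ = l * ‖u‖ ^ 2 - ⟪poincareOperator hΩ D u, u⟫_ℝ := fun u => by
    simp [Algebra.algebraMap_eq_smul_one, inner_sub_left, inner_smul_left]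
  by_contra hnot
  rw [mem_Icc, not_and_or, not_le, not_le] at hnot
  refine hl ?_
  rcases hnot with h0 | h1
  · rw [← IsUnit.neg_iff]
    refine isUnit_of_coercive _ (neg_pos.2 h0) fun u => ?_
    have := poincareOperator_inner_self_nonneg hΩ D u
    rw [neg_apply, inner_neg_left, hin]
    linarith
  · refine isUnit_of_coercive _ (sub_pos.2 h1) fun u => ?_
    have := poincareOperator_inner_self_le hΩ hD u
    rw [hin]
    linarith

/-- The coefficient `l - 1_D` of the divergence form operator associated with `l - T_D`. -/
noncomputable def coeff (D : Set Plane) (l : ℝ) (x : Plane) : ℝ :=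
  l - D.indicator (fun _ => 1) x

/-- If `(l - 1_D)∇u` is a rotated gradient up to an error `e`, then `(l - T_D) u` is at most as
large as this error. -/
theorem norm_sub_poincareOperator_le {Ω D : Set Plane} (hΩ : Bornology.IsBounded Ω)
    (hDm : MeasurableSet D) (hD : D ⊆ Ω) {l : ℝ} {i j : Fin 2} {u w : H10 Ω hΩ}
    {e : L2Vec Ω}
    (he : ∀ᵐ x ∂(volume.restrict Ω), coeff D l x • u.grad x = rot i j (w.grad x) + e x) :
    ‖(algebraMap ℝ (H10 Ω hΩ →L[ℝ] H10 Ω hΩ) l - poincareOperator hΩ D) u‖ ≤ ‖e‖ := by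
  set v := (algebraMap ℝ (H10 Ω hΩ →L[ℝ] H10 Ω hΩ) l - poincareOperator hΩ D) u with hv
  have hint : ∀ a b : L2Vec Ω, Integrable (fun x => ⟪a x, b x⟫_ℝ) (volume.restrict Ω) :=
    fun a b => L2.integrable_inner a b
  have hind : ∀ x, D.indicator (fun x => ⟪u.grad x, v.grad x⟫_ℝ) x =
      D.indicator (fun _ => (1 : ℝ)) x * ⟪u.grad x, v.grad x⟫_ℝ := fun x => by
    by_cases hx : x ∈ D <;> simp [hx]
  have h1 : ⟪v, v⟫_ℝ = ∫ x in Ω, ⟪coeff D l x • u.grad x, v.grad x⟫_ℝ := by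
    have hstep : ⟪v, v⟫_ℝ = l * ⟪u, v⟫_ℝ - ⟪poincareOperator hΩ D u, v⟫_ℝ := by
      nth_rewrite 1 [hv]
      simp [Algebra.algebraMap_eq_smul_one, inner_sub_left, inner_smul_left]
    rw [hstep, H10.inner_eq, H10.inner_eq, poincareOperator_spec hΩ hD,
      ← Measure.restrict_restrict_of_subset (μ := volume) hD, ← integral_indicator hDm,
      ← integral_const_mul, ← integral_sub ((hint _ _).const_mul l) ((hint _ _).indicator hDm)]
    refine integral_congr_ae (Eventually.of_forall fun x => ?_)
    simp only [hind, coeff, inner_smul_left, conj_trivial]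
    ring
  have h2 : ⟪v, v⟫_ℝ = ⟪e, v.grad⟫_ℝ := by
    rw [h1, L2.inner_def, ← zero_add (∫ x in Ω, ⟪e x, v.grad x⟫_ℝ),
      ← integral_inner_rot_grad i j w v, ← integral_add ?_ (hint _ _)]
    · refine integral_congr_ae ?_
      filter_upwards [he] with x hx
      rw [hx, inner_add_left]
    · refine (hint ((rot i j).compLp w.grad) v.grad).congr ?_
      filter_upwards [(rot i j).coeFn_compLp w.grad] with x hx
      rw [hx]
  have h3 : ‖v‖ * ‖v‖ ≤ ‖e‖ * ‖v‖ := by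
    rw [← real_inner_self_eq_norm_mul_norm, h2, H10.norm_eq v]
    exact real_inner_le_norm _ _
  rcases (norm_nonneg v).eq_or_lt with h0 | h0
  · rw [← h0]; exact norm_nonneg e
  · exact le_of_mul_le_mul_right h3 h0

/-- Outside the spectrum, an operator is bounded below. -/
theorem exists_bound_of_notMem_spectrum {H : Type*} [NormedAddCommGroup H]
    [InnerProductSpace ℝ H] {T : H →L[ℝ] H} {l : ℝ} (hl : l ∉ spectrum ℝ T) :
    ∃ K : ℝ, 0 ≤ K ∧ ∀ u, ‖u‖ ≤ K * ‖(algebraMap ℝ (H →L[ℝ] H) l - T) u‖ := by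
  obtain ⟨S, hS⟩ := spectrum.notMem_iff.1 hl
  refine ⟨‖(↑S⁻¹ : H →L[ℝ] H)‖, norm_nonneg _, fun u => ?_⟩
  have : (↑S⁻¹ : H →L[ℝ] H) ((S : H →L[ℝ] H) u) = u := by
    rw [← mul_apply_eq_comp, S.inv_mul, one_apply_eq_self]
  calc ‖u‖ = ‖(↑S⁻¹ : H →L[ℝ] H) ((S : H →L[ℝ] H) u)‖ := by rw [this]
    _ ≤ _ := by rw [← hS]; exact ContinuousLinearMap.le_opNorm _ _

/-! ### Functions with separated variables in polar coordinates -/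

/-- The signed angle, in `[-π/2, π/2]`, between `x` and the line `x j = 0`; it is `0` at `x = 0`. -/
noncomputable def elevation (j : Fin 2) (x : Plane) : ℝ := Real.arcsin (x j / ‖x‖)

theorem elevation_mem_Icc (j : Fin 2) (x : Plane) :
    elevation j x ∈ Icc (-(Real.pi / 2)) (Real.pi / 2) :=
  Real.arcsin_mem_Icc _

theorem elevation_eq_sub_angle (j : Fin 2) (x : Plane) :
    elevation j x = Real.pi / 2 - InnerProductGeometry.angle x (EuclideanSpace.single j 1) := by
  rw [elevation, InnerProductGeometry.angle, Real.arccos, EuclideanSpace.inner_single_right]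
  simp

/-- The angle between two vectors is controlled by the distance between their directions. -/
theorem angle_le_mul_norm_sub {ε : ℝ} (hε : 0 < ε) {x y : Plane} (hx : ε ≤ ‖x‖) (hy : ε ≤ ‖y‖) :
    InnerProductGeometry.angle x y ≤ Real.pi / (2 * ε) * ‖x - y‖ := by
  have hx0 : 0 < ‖x‖ := hε.trans_le hx
  have hy0 : 0 < ‖y‖ := hε.trans_le hy
  set θ := InnerProductGeometry.angle x y with hθ
  have hθ0 : 0 ≤ θ := InnerProductGeometry.angle_nonneg x y
  have hθπ : |θ| ≤ Real.pi := by
    rw [abs_of_nonneg hθ0]; exact InnerProductGeometry.angle_le_pi x y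
  have hcos := Real.cos_le_one_sub_mul_cos_sq hθπ
  have hlaw := InnerProductGeometry.norm_sub_sq_eq_norm_sq_add_norm_sq_sub_two_mul_norm_mul_norm_mul_cos_angle x y
  rw [← hθ] at hlaw
  have hprod : ε ^ 2 ≤ ‖x‖ * ‖y‖ := by rw [sq]; gcongr
  -- the law of cosines, and `cos θ ≤ 1 - 2 θ² / π²`
  have hmain : (2 * ε * θ / Real.pi) ^ 2 ≤ ‖x - y‖ ^ 2 := by
    have h1 : 2 / Real.pi ^ 2 * θ ^ 2 ≤ 1 - Real.cos θ := by linarith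
    have h2 : ε ^ 2 * (2 / Real.pi ^ 2 * θ ^ 2) ≤ ‖x‖ * ‖y‖ * (1 - Real.cos θ) := by gcongr
    have h3 : (2 * ε * θ / Real.pi) ^ 2 = 2 * (ε ^ 2 * (2 / Real.pi ^ 2 * θ ^ 2)) := by ring
    nlinarith [sq_nonneg (‖x‖ - ‖y‖)]
  have h := le_of_sq_le_sq hmain (norm_nonneg _)
  have hpi := Real.pi_pos
  rw [div_le_iff₀ hpi] at h
  rw [div_mul_eq_mul_div, le_div_iff₀ (by positivity)]
  linarith

theorem abs_elevation_sub_le {ε : ℝ} (hε : 0 < ε) (j : Fin 2) {x y : Plane} (hx : ε ≤ ‖x‖)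
    (hy : ε ≤ ‖y‖) :
    |elevation j x - elevation j y| ≤ Real.pi / (2 * ε) * ‖x - y‖ := by
  refine le_trans ?_ (angle_le_mul_norm_sub hε hx hy)
  rw [elevation_eq_sub_angle, elevation_eq_sub_angle, abs_le]
  have h1 := InnerProductGeometry.angle_le_angle_add_angle x y (EuclideanSpace.single j 1)
  have h2 := InnerProductGeometry.angle_le_angle_add_angle y x (EuclideanSpace.single j 1)
  rw [InnerProductGeometry.angle_comm y x] at h2
  constructor <;> linarith

theorem abs_log_norm_sub_le {ε : ℝ} (hε : 0 < ε) {x y : Plane} (hx : ε ≤ ‖x‖) (hy : ε ≤ ‖y‖) :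
    |Real.log ‖x‖ - Real.log ‖y‖| ≤ 1 / ε * ‖x - y‖ := by
  have aux : ∀ {x y : Plane}, ε ≤ ‖x‖ → ε ≤ ‖y‖ →
      Real.log ‖x‖ - Real.log ‖y‖ ≤ 1 / ε * ‖x - y‖ := fun {x y} hx hy => by
    have hx0 : 0 < ‖x‖ := hε.trans_le hx
    have hy0 : 0 < ‖y‖ := hε.trans_le hy
    rw [← Real.log_div hx0.ne' hy0.ne']
    calc Real.log (‖x‖ / ‖y‖) ≤ ‖x‖ / ‖y‖ - 1 := Real.log_le_sub_one_of_pos (by positivity)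
      _ = 1 / ‖y‖ * (‖x‖ - ‖y‖) := by field_simp
      _ ≤ 1 / ‖y‖ * ‖x - y‖ := by gcongr; exact norm_sub_norm_le x y
      _ ≤ 1 / ε * ‖x - y‖ := by gcongr
  rw [abs_le]
  have h2 := aux hy hx
  rw [norm_sub_rev] at h2
  constructor <;> linarith [aux hx hy]

/-- The function `g (log r) G(t)`, where `r` is the distance to the origin and `t` the angle with
the line `x j = 0`. -/
noncomputable def polarFun (g G : ℝ → ℝ) (j : Fin 2) (x : Plane) : ℝ :=
  g (Real.log ‖x‖) * G (elevation j x)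

section Lipschitz

variable {g G : ℝ → ℝ} {a : ℝ}

theorem polarFun_support_subset (ha : a < 0) (hg : tsupport g ⊆ Iic a) (j : Fin 2) :
    Function.support (polarFun g G j) ⊆ Metric.closedBall 0 (Real.exp a) := by
  intro x hx
  have hgx : g (Real.log ‖x‖) ≠ 0 := left_ne_zero_of_mul hx
  have hlog : Real.log ‖x‖ ≤ a := hg (subset_tsupport g hgx)
  have hx0 : 0 < ‖x‖ := by
    refine (norm_nonneg x).lt_of_ne' fun h0 => ?_
    rw [h0, Real.log_zero] at hlog
    linarith
  rw [mem_closedBall_zero_iff]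
  exact (Real.log_le_iff_le_exp hx0).1 hlog

theorem tsupport_polarFun_subset (ha : a < 0) (hg : tsupport g ⊆ Iic a) (j : Fin 2) :
    tsupport (polarFun g G j) ⊆ Metric.closedBall 0 (Real.exp a) :=
  closure_minimal (polarFun_support_subset ha hg j) Metric.isClosed_closedBall

theorem hasCompactSupport_polarFun (ha : a < 0) (hg : tsupport g ⊆ Iic a) (j : Fin 2) :
    HasCompactSupport (polarFun g G j) :=
  HasCompactSupport.of_support_subset_isCompact (isCompact_closedBall 0 (Real.exp a))
    (polarFun_support_subset ha hg j)

theorem exists_lipschitzWith_polarFun (ha : a < 0) (hg : tsupport g ⊆ Iic a)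
    (hgs : ContDiff ℝ ∞ g) (hgc : HasCompactSupport g) {K : ℝ≥0}
    (hG : LipschitzOnWith K G (Icc (-(Real.pi / 2)) (Real.pi / 2))) (j : Fin 2) :
    ∃ C : ℝ≥0, LipschitzWith C (polarFun g G j) := by
  obtain ⟨L, hL⟩ := hgs.lipschitzWith_of_hasCompactSupport hgc (by simp)
  obtain ⟨M, hM⟩ := hgc.exists_bound_of_continuous hgs.continuous
  obtain ⟨N, hN⟩ := isCompact_Icc.exists_bound_of_continuousOn hG.continuousOn
  obtain ⟨b, hb⟩ := hgc.isCompact.bddBelow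
  have hM0 : 0 ≤ M := (norm_nonneg _).trans (hM 0)
  have hN0 : 0 ≤ N := (norm_nonneg _).trans (hN _ (elevation_mem_Icc j 0))
  set ε : ℝ := Real.exp b / 2 with hεdef
  have hε : 0 < ε := by positivity
  -- the function vanishes near the origin, where the polar coordinates are singular
  have hzero : ∀ x : Plane, ‖x‖ < 2 * ε → polarFun g G j x = 0 := fun x hx => by
    by_contra h
    have hgx : g (Real.log ‖x‖) ≠ 0 := left_ne_zero_of_mul h
    have hmem := subset_tsupport g hgx
    have hlog : Real.log ‖x‖ ≤ a := hg hmem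
    have hx0 : 0 < ‖x‖ := by
      refine (norm_nonneg x).lt_of_ne' fun h0 => ?_
      rw [h0, Real.log_zero] at hlog
      linarith
    have := (Real.le_log_iff_exp_le hx0).1 (hb hmem)
    linarith
  have hbd : ∀ x, ‖polarFun g G j x‖ ≤ M * N := fun x => by
    rw [polarFun, norm_mul]
    exact mul_le_mul (hM _) (hN _ (elevation_mem_Icc j x)) (norm_nonneg _) hM0
  have hout : ∀ x y : Plane, ε ≤ ‖x‖ → ε ≤ ‖y‖ → ‖polarFun g G j x - polarFun g G j y‖ ≤
      (M * (K * (Real.pi / (2 * ε))) + N * (L * (1 / ε))) * ‖x - y‖ := fun x y hx hy => by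
    have h1 : ‖g (Real.log ‖x‖) - g (Real.log ‖y‖)‖ ≤ L * (1 / ε * ‖x - y‖) :=
      (hL.norm_sub_le _ _).trans (by gcongr; exact abs_log_norm_sub_le hε hx hy)
    have h2 : ‖G (elevation j x) - G (elevation j y)‖ ≤
        K * (Real.pi / (2 * ε) * ‖x - y‖) :=
      (hG.norm_sub_le (elevation_mem_Icc j x) (elevation_mem_Icc j y)).trans
        (by gcongr; exact abs_elevation_sub_le hε j hx hy)
    calc ‖polarFun g G j x - polarFun g G j y‖
        = ‖g (Real.log ‖x‖) * (G (elevation j x) - G (elevation j y)) +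
            (g (Real.log ‖x‖) - g (Real.log ‖y‖)) * G (elevation j y)‖ := by
          rw [polarFun, polarFun]; ring_nf
      _ ≤ M * (K * (Real.pi / (2 * ε) * ‖x - y‖)) + L * (1 / ε * ‖x - y‖) * N := by
          refine (norm_add_le _ _).trans ?_
          rw [norm_mul, norm_mul]
          gcongr
          · exact hM _
          · exact hN _ (elevation_mem_Icc j y)
      _ = _ := by ring
  set C : ℝ := max (M * (K * (Real.pi / (2 * ε))) + N * (L * (1 / ε))) (M * N / ε) with hC
  have hC0 : 0 ≤ C := le_max_of_le_right (by positivity)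
  have hin : ∀ x y : Plane, ‖x‖ < ε →
      ‖polarFun g G j x - polarFun g G j y‖ ≤ C * ‖x - y‖ := fun x y hx => by
    rw [hzero x (by linarith), zero_sub, norm_neg]
    rcases lt_or_ge ‖y‖ (2 * ε) with hy | hy
    · rw [hzero y hy, norm_zero]; positivity
    · have hxy : ε ≤ ‖x - y‖ := by
        have := norm_sub_norm_le y x
        rw [norm_sub_rev] at this
        linarith
      calc _ ≤ M * N / ε * ε := by rw [div_mul_cancel₀ _ hε.ne']; exact hbd y
        _ ≤ C * ‖x - y‖ := by gcongr; exact le_max_right _ _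
  refine ⟨⟨C, hC0⟩, LipschitzWith.of_dist_le_mul fun x y => ?_⟩
  rw [dist_eq_norm, dist_eq_norm]
  change _ ≤ C * _
  rcases lt_or_ge ‖x‖ ε with hx | hx
  · exact hin x y hx
  rcases lt_or_ge ‖y‖ ε with hy | hy
  · rw [norm_sub_rev, norm_sub_rev x y]
    exact hin y x hy
  · exact (hout x y hx hy).trans (by gcongr; exact le_max_left _ _)

end Lipschitz

theorem norm_sq_eq_add_sq {i j : Fin 2} (hij : i ≠ j) (x : Plane) :
    ‖x‖ ^ 2 = x i ^ 2 + x j ^ 2 := by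
  rw [EuclideanSpace.real_norm_sq_eq, Fin.sum_univ_two]
  fin_cases i <;> fin_cases j <;> simp_all [add_comm]

theorem hasFDerivAt_log_norm {x : Plane} (hx : x ≠ 0) :
    HasFDerivAt (fun y : Plane => Real.log ‖y‖) ((‖x‖ ^ 2)⁻¹ • innerSL ℝ x) x := by
  have h0 : ‖x‖ ^ 2 ≠ 0 := by positivity
  have h := ((hasStrictFDerivAt_norm_sq x).hasFDerivAt.log h0).const_mul (1 / 2)
  refine (h.congr_of_eventuallyEq (Eventually.of_forall fun y => ?_)).congr_fderiv ?_
  · simp only [Real.log_pow]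
    push_cast
    ring
  · ext v
    simp
    ring

theorem hasFDerivAt_elevation {i j : Fin 2} (hij : i ≠ j) {x : Plane} (hxi : x i ≠ 0) :
    HasFDerivAt (elevation j) ((|x i| * ‖x‖ ^ 2)⁻¹ •
      (‖x‖ ^ 2 • (EuclideanSpace.proj j : Plane →L[ℝ] ℝ) - x j • innerSL ℝ x)) x := by
  have hx : x ≠ 0 := by rintro rfl; simp at hxi
  have hr : 0 < ‖x‖ := norm_pos_iff.2 hx
  have hsq := norm_sq_eq_add_sq hij x
  have hnorm : HasFDerivAt (fun y : Plane => ‖y‖) (‖x‖⁻¹ • innerSL ℝ x) x := by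
    have h := (hasStrictFDerivAt_norm_sq x).hasFDerivAt.sqrt (by positivity)
    refine (h.congr_of_eventuallyEq (Eventually.of_forall fun y => ?_)).congr_fderiv ?_
    · simp
    · ext v
      simp
      field_simp
  have hquot : HasFDerivAt (fun y : Plane => y j / ‖y‖) ((‖x‖ ^ 2)⁻¹ •
      (‖x‖ • (EuclideanSpace.proj j : Plane →L[ℝ] ℝ) - x j • ‖x‖⁻¹ • innerSL ℝ x)) x := by
    refine (((EuclideanSpace.proj j : Plane →L[ℝ] ℝ).hasFDerivAt.mul
      ((hasDerivAt_inv hr.ne').comp_hasFDerivAt x hnorm)).congr_of_eventuallyEq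
      (Eventually.of_forall fun y => div_eq_mul_inv _ _)).congr_fderiv ?_
    ext v
    simp
    field_simp
    ring
  have habs : Real.sqrt (1 - (x j / ‖x‖) ^ 2) = |x i| / ‖x‖ := by
    rw [show 1 - (x j / ‖x‖) ^ 2 = (x i / ‖x‖) ^ 2 by
      rw [div_pow, div_pow, eq_div_iff (by positivity), sub_mul, div_mul_cancel₀ _ (by positivity)]
      linarith, Real.sqrt_sq_eq_abs, abs_div, abs_of_pos hr]
  have hne : (x j / ‖x‖) ^ 2 ≠ 1 := fun h => by
    rw [h, sub_self, Real.sqrt_zero, eq_comm, div_eq_zero_iff, abs_eq_zero] at habs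
    exact habs.elim hxi hr.ne'
  have h := (Real.hasDerivAt_arcsin (x := x j / ‖x‖) (by rintro h; simp [h] at hne)
    (by rintro h; simp [h] at hne)).comp_hasFDerivAt x hquot
  refine h.congr_fderiv ?_
  rw [habs]
  have hxi' : |x i| ≠ 0 := abs_ne_zero.2 hxi
  ext v
  simp
  field_simp

section Gradient

variable {g G : ℝ → ℝ} {i j : Fin 2} {x : Plane} {g' G' : ℝ}

theorem hasFDerivAt_polarFun (hij : i ≠ j) (hxi : x i ≠ 0)
    (hg : HasDerivAt g g' (Real.log ‖x‖)) (hG : HasDerivAt G G' (elevation j x)) :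
    HasFDerivAt (polarFun g G j)
      (g (Real.log ‖x‖) • G' • ((|x i| * ‖x‖ ^ 2)⁻¹ •
        (‖x‖ ^ 2 • (EuclideanSpace.proj j : Plane →L[ℝ] ℝ) - x j • innerSL ℝ x)) +
      G (elevation j x) • g' • (‖x‖ ^ 2)⁻¹ • innerSL ℝ x) x := by
  have hx : x ≠ 0 := by rintro rfl; simp at hxi
  exact (hg.comp_hasFDerivAt x (hasFDerivAt_log_norm hx)).mul
    (hG.comp_hasFDerivAt x (hasFDerivAt_elevation hij hxi))

theorem gradient_polarFun_self (hij : i ≠ j) (hxi : x i ≠ 0)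
    (hg : HasDerivAt g g' (Real.log ‖x‖)) (hG : HasDerivAt G G' (elevation j x)) :
    (∇ (polarFun g G j) x) j = (g' * G (elevation j x) * x j +
      g (Real.log ‖x‖) * G' * |x i|) / ‖x‖ ^ 2 := by
  have hx : x ≠ 0 := by rintro rfl; simp at hxi
  have hr : 0 < ‖x‖ := norm_pos_iff.2 hx
  have hxi' : |x i| ≠ 0 := abs_ne_zero.2 hxi
  have hsq := norm_sq_eq_add_sq hij x
  rw [gradient_apply, (hasFDerivAt_polarFun hij hxi hg hG).fderiv]
  simp [EuclideanSpace.inner_single_right]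
  field_simp
  rw [hsq]
  linear_combination (-g (Real.log ‖x‖) * G') * sq_abs (x i)

theorem gradient_polarFun_other (hij : i ≠ j) (hxi : x i ≠ 0)
    (hg : HasDerivAt g g' (Real.log ‖x‖)) (hG : HasDerivAt G G' (elevation j x)) :
    (∇ (polarFun g G j) x) i = (g' * G (elevation j x) * x i -
      g (Real.log ‖x‖) * G' * (x i / |x i|) * x j) / ‖x‖ ^ 2 := by
  have hx : x ≠ 0 := by rintro rfl; simp at hxi
  have hr : 0 < ‖x‖ := norm_pos_iff.2 hx
  have hxi' : |x i| ≠ 0 := abs_ne_zero.2 hxi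
  rw [gradient_apply, (hasFDerivAt_polarFun hij hxi hg hG).fderiv]
  simp [EuclideanSpace.inner_single_right, hij]
  field_simp
  ring

end Gradient

/-! ### The angular profile -/

/-- The angular factor of the quasi-modes, as a function of the angle `t` with the axis of the
central sector `|t| < γ`: the odd function with `Φ'' = ξ² Φ` in `|t| < γ` and in `γ < t < π/2`,
continuous at `γ`, and even about `π/2`. It equals `cosh (ξ (π/2 - γ)) sinh (ξ t)` for `|t| ≤ γ`
and `sinh (ξ γ) cosh (ξ (π/2 - t))` for `t ≥ γ`; the formula by truncations makes it visibly
Lipschitz. -/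
noncomputable def angular (ξ γ t : ℝ) : ℝ :=
  Real.cosh (ξ * (Real.pi / 2 - γ)) * Real.sinh (ξ * max (-γ) (min t γ)) +
    Real.sinh (ξ * γ) * (Real.cosh (ξ * (Real.pi / 2 - max t γ)) -
      Real.cosh (ξ * (Real.pi / 2 - max (-t) γ)))

/-- The derivative of `angular ξ γ` away from `±γ`. -/
noncomputable def angularDeriv (ξ γ t : ℝ) : ℝ :=
  if |t| < γ then ξ * Real.cosh (ξ * (Real.pi / 2 - γ)) * Real.cosh (ξ * t)
  else -(ξ * Real.sinh (ξ * γ) * Real.sinh (ξ * (Real.pi / 2 - |t|)))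

section Angular

variable {ξ γ t : ℝ}

theorem angular_of_abs_le (h : |t| ≤ γ) :
    angular ξ γ t = Real.cosh (ξ * (Real.pi / 2 - γ)) * Real.sinh (ξ * t) := by
  obtain ⟨h1, h2⟩ := abs_le.1 h
  rw [angular, min_eq_left h2, max_eq_right h1, max_eq_right h2,
    max_eq_right (show -t ≤ γ by linarith)]
  ring

theorem angular_neg (hγ : 0 ≤ γ) : angular ξ γ (-t) = -angular ξ γ t := by
  have : max (-γ) (min (-t) γ) = -max (-γ) (min t γ) := by
    grind
  rw [angular, angular, this, mul_neg, Real.sinh_neg, neg_neg]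
  ring

theorem angular_of_le (hγ : 0 ≤ γ) (h : γ ≤ t) :
    angular ξ γ t = Real.sinh (ξ * γ) * Real.cosh (ξ * (Real.pi / 2 - t)) := by
  rw [angular, min_eq_right h, max_eq_right (show -γ ≤ γ by linarith), max_eq_left h,
    max_eq_right (show -t ≤ γ by linarith)]
  ring

theorem angularDeriv_neg : angularDeriv ξ γ (-t) = angularDeriv ξ γ t := by
  simp [angularDeriv]

theorem hasDerivAt_angular_of_abs_lt (h : |t| < γ) :
    HasDerivAt (angular ξ γ) (angularDeriv ξ γ t) t := by
  rw [angularDeriv, if_pos h]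
  have h1 : HasDerivAt (fun s => Real.cosh (ξ * (Real.pi / 2 - γ)) * Real.sinh (ξ * s))
      (Real.cosh (ξ * (Real.pi / 2 - γ)) * (Real.cosh (ξ * t) * (ξ * 1))) t :=
    (((hasDerivAt_id t).const_mul ξ).sinh).const_mul _
  refine (h1.congr_of_eventuallyEq ?_).congr_deriv (by ring)
  filter_upwards [(continuous_abs.tendsto t).eventually_lt_const h] with s hs
  exact angular_of_abs_le hs.le

theorem hasDerivAt_angular_of_lt (hγ : 0 ≤ γ) (h : γ < t) :
    HasDerivAt (angular ξ γ) (angularDeriv ξ γ t) t := by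
  rw [angularDeriv, abs_of_pos (hγ.trans_lt h), if_neg h.not_gt]
  have h1 : HasDerivAt (fun s => Real.sinh (ξ * γ) * Real.cosh (ξ * (Real.pi / 2 - s)))
      (Real.sinh (ξ * γ) * (Real.sinh (ξ * (Real.pi / 2 - t)) * (ξ * (-1)))) t :=
    ((((hasDerivAt_id t).const_sub (Real.pi / 2)).const_mul ξ).cosh).const_mul _
  refine (h1.congr_of_eventuallyEq ?_).congr_deriv (by ring)
  filter_upwards [lt_mem_nhds h] with s hs
  exact angular_of_le hγ hs.le

theorem hasDerivAt_angular (hγ : 0 ≤ γ) (h : |t| ≠ γ) :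
    HasDerivAt (angular ξ γ) (angularDeriv ξ γ t) t := by
  rcases lt_or_gt_of_ne h with h | h
  · exact hasDerivAt_angular_of_abs_lt h
  rcases lt_abs.1 h with h | h
  · exact hasDerivAt_angular_of_lt hγ h
  · have h1 := (hasDerivAt_angular_of_lt (ξ := ξ) hγ h).comp t (hasDerivAt_neg t)
    have h2 : angular ξ γ = fun s => -(angular ξ γ ∘ Neg.neg) s := by
      ext s
      rw [Function.comp_apply, angular_neg hγ, neg_neg]
    rw [h2]
    refine h1.neg.congr_deriv ?_
    rw [angularDeriv_neg]
    ring

theorem exists_lipschitzOnWith_angular (ξ : ℝ) {γ : ℝ} (hγ : 0 ≤ γ) (hγ' : γ ≤ Real.pi / 2) :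
    ∃ K, LipschitzOnWith K (angular ξ γ) (Icc (-(Real.pi / 2)) (Real.pi / 2)) := by
  have hsm : ∀ F : ℝ → ℝ, ContDiff ℝ 1 F → ∃ K, LipschitzOnWith K F
      (Icc (-(Real.pi / 2)) (Real.pi / 2)) := fun F hF =>
    hF.contDiffOn.exists_lipschitzOnWith one_ne_zero (convex_Icc _ _) isCompact_Icc
  have hcomp : ∀ F p : ℝ → ℝ, ContDiff ℝ 1 F → LipschitzWith 1 p →
      MapsTo p (Icc (-(Real.pi / 2)) (Real.pi / 2)) (Icc (-(Real.pi / 2)) (Real.pi / 2)) →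
      ∃ K, LipschitzOnWith K (fun s => F (p s)) (Icc (-(Real.pi / 2)) (Real.pi / 2)) :=
    fun F p hF hp hm => by
      obtain ⟨K, hK⟩ := hsm F hF
      exact ⟨K * 1, hK.comp hp.lipschitzOnWith hm⟩
  obtain ⟨K₁, h1⟩ := hcomp
    (fun s => Real.cosh (ξ * (Real.pi / 2 - γ)) * Real.sinh (ξ * s))
    (fun s => max (-γ) (min s γ)) (by fun_prop)
    ((LipschitzWith.id.min_const γ).const_max (-γ))
    (fun s hs => ⟨le_max_of_le_left (by linarith),
      max_le (by linarith) ((min_le_right _ _).trans hγ')⟩)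
  obtain ⟨K₂, h2⟩ := hcomp
    (fun s => Real.sinh (ξ * γ) * Real.cosh (ξ * (Real.pi / 2 - s)))
    (fun s => max s γ) (by fun_prop) (LipschitzWith.id.max_const γ)
    (fun s hs => ⟨le_max_of_le_left hs.1, max_le hs.2 hγ'⟩)
  obtain ⟨K₃, h3⟩ := hcomp
    (fun s => Real.sinh (ξ * γ) * Real.cosh (ξ * (Real.pi / 2 - s)))
    (fun s => max (-s) γ) (by fun_prop) (LipschitzWith.id.neg.max_const γ)
    (fun s hs => ⟨le_max_of_le_left (by linarith [hs.2]), max_le (by linarith [hs.1]) hγ'⟩)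
  have heq : angular ξ γ = fun s =>
      Real.cosh (ξ * (Real.pi / 2 - γ)) * Real.sinh (ξ * max (-γ) (min s γ)) +
        (Real.sinh (ξ * γ) * Real.cosh (ξ * (Real.pi / 2 - max s γ)) -
          Real.sinh (ξ * γ) * Real.cosh (ξ * (Real.pi / 2 - max (-s) γ))) := by
    ext s
    rw [angular]
    ring
  rw [heq]
  exact ⟨_, h1.add (h2.sub h3)⟩

/-- The energy density of the angular profile is bounded below. -/
theorem exists_angular_energy_ge (hξ : 0 < ξ) (hγ : 0 < γ) :
    ∃ c > 0, ∀ t, c ≤ ξ ^ 2 * angular ξ γ t ^ 2 + angularDeriv ξ γ t ^ 2 := by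
  have hs : 0 < Real.sinh (ξ * γ) := Real.sinh_pos_iff.2 (by positivity)
  refine ⟨min (ξ ^ 2) (ξ ^ 2 * Real.sinh (ξ * γ) ^ 2), by positivity, fun t => ?_⟩
  rcases lt_or_ge |t| γ with h | h
  · refine (min_le_left _ _).trans ?_
    rw [angularDeriv, if_pos h]
    have h1 := Real.one_le_cosh (ξ * (Real.pi / 2 - γ))
    have h2 := Real.one_le_cosh (ξ * t)
    have h3 : 1 ≤ Real.cosh (ξ * (Real.pi / 2 - γ)) * Real.cosh (ξ * t) := by nlinarith
    nlinarith [mul_nonneg (sq_nonneg ξ) (sq_nonneg (angular ξ γ t)), sq_nonneg ξ,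
      mul_le_mul_of_nonneg_left (one_le_pow₀ h3 (n := 2)) (sq_nonneg ξ)]
  · refine (min_le_right _ _).trans ?_
    have hval : angular ξ γ t ^ 2 =
        (Real.sinh (ξ * γ) * Real.cosh (ξ * (Real.pi / 2 - |t|))) ^ 2 := by
      rw [← angular_of_le hγ.le h]
      rcases abs_choice t with h' | h' <;> rw [h']
      rw [angular_neg hγ.le, neg_sq]
    rw [hval, mul_pow, ← mul_assoc]
    have h2 := one_le_pow₀ (Real.one_le_cosh (ξ * (Real.pi / 2 - |t|))) (n := 2)
    nlinarith [sq_nonneg (angularDeriv ξ γ t),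
      mul_le_mul_of_nonneg_left h2 (by positivity : 0 ≤ ξ ^ 2 * Real.sinh (ξ * γ) ^ 2)]

end Angular

/-- The transmission conditions at `±γ` for the profile `angular ξ γ`, the coefficient being `a` in
the sector `|t| < γ` and `b` outside. Eliminating `κ` gives the continuity at `γ` of the flux, the
coefficient times the derivative of the profile; the flux is then `ξ κ` times the profile
`angular ξ (π/2 - γ)`, read in the complementary angle. -/
structure Transmission (ξ γ a b κ : ℝ) : Prop where
  pos : 0 < ξ
  left : a * Real.cosh (ξ * (Real.pi / 2 - γ)) = κ * Real.sinh (ξ * (Real.pi / 2 - γ))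
  right : -(b * Real.sinh (ξ * γ)) = κ * Real.cosh (ξ * γ)

/-- When the coefficients have opposite signs and the outer one is larger in absolute value, some
frequency `ξ` satisfies the transmission conditions, because `tanh (ξ γ) tanh (ξ (π/2 - γ))` takes
all values in `(0, 1)`. -/
theorem exists_transmission {γ a b : ℝ} (hγ : 0 < γ) (hγ' : γ < Real.pi / 2)
    (h0 : 0 < -a / b) (h1 : -a / b < 1) : ∃ ξ κ, Transmission ξ γ a b κ := by
  set m := -a / b with hm
  have hb : b ≠ 0 := by rintro rfl; simp at hm; linarith
  set δ := Real.pi / 2 - γ with hδdef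
  have hδ : 0 < δ := sub_pos.2 hγ'
  have hcont : Continuous fun ξ => Real.tanh (ξ * γ) * Real.tanh (ξ * δ) := by
    simp only [Real.tanh_eq_sinh_div_cosh]
    exact (Continuous.div (by fun_prop) (by fun_prop) fun x => (Real.cosh_pos _).ne').mul
      (Continuous.div (by fun_prop) (by fun_prop) fun x => (Real.cosh_pos _).ne')
  have hs : √m ∈ Ioo (-1 : ℝ) 1 :=
    ⟨by linarith [Real.sqrt_nonneg m], (Real.sqrt_lt' one_pos).2 (by simpa using h1)⟩
  set X := Real.artanh √m with hX
  have hmono : ∀ y, X ≤ y → √m ≤ Real.tanh y := fun y hy => by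
    rw [← Real.artanh_tanh y] at hy
    exact (Real.artanh_le_artanh_iff hs ⟨Real.neg_one_lt_tanh y, Real.tanh_lt_one y⟩).1 hy
  have hX0 : 0 < X := Real.artanh_pos ⟨Real.sqrt_pos.2 h0, hs.2⟩
  set Y := X / γ + X / δ with hY
  have hY0 : 0 < Y := by positivity
  have hYm : m ≤ Real.tanh (Y * γ) * Real.tanh (Y * δ) := by
    rw [← Real.mul_self_sqrt h0.le]
    have e1 : X ≤ Y * γ := by
      rw [hY, add_mul, div_mul_cancel₀ _ hγ.ne']
      linarith [show 0 < X / δ * γ by positivity]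
    have e2 : X ≤ Y * δ := by
      rw [hY, add_mul, div_mul_cancel₀ X hδ.ne']
      linarith [show 0 < X / γ * δ by positivity]
    exact mul_le_mul (hmono _ e1) (hmono _ e2) (Real.sqrt_nonneg _)
      ((Real.sqrt_nonneg _).trans (hmono _ e1))
  obtain ⟨ξ, ⟨hξ0, -⟩, hξ⟩ := intermediate_value_Icc hY0.le hcont.continuousOn
    (show m ∈ Icc _ _ from ⟨by simpa using h0.le, hYm⟩)
  have hξpos : 0 < ξ := by
    refine hξ0.lt_of_ne' fun h => ?_
    simp [h] at hξ
    linarith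
  have hξ' : Real.tanh (ξ * γ) * Real.tanh (ξ * δ) * b = -a := by
    rw [show Real.tanh (ξ * γ) * Real.tanh (ξ * δ) = m from hξ, hm, div_mul_cancel₀ _ hb]
  have hc1 := (Real.cosh_pos (ξ * γ)).ne'
  have hc2 := (Real.cosh_pos (ξ * δ)).ne'
  refine ⟨ξ, -(b * Real.tanh (ξ * γ)), hξpos, ?_, ?_⟩
  · rw [← hδdef, ← neg_inj, ← neg_mul, ← hξ']
    simp only [Real.tanh_eq_sinh_div_cosh]
    field_simp
  · rw [Real.tanh_eq_sinh_div_cosh]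
    field_simp

section Conjugate

variable {ξ γ a b κ τ : ℝ}

/-- The flux `a Φ'` is a multiple of the profile of the complementary sectors. -/
theorem Transmission.angular_conj (h : Transmission ξ γ a b κ)
    (hγ' : γ < Real.pi / 2) (hτ : τ ≠ γ) (hτ0 : 0 < τ) (hτ' : τ < Real.pi / 2) :
    ξ * κ * angular ξ (Real.pi / 2 - γ) (Real.pi / 2 - τ) =
      (if τ < γ then a else b) * angularDeriv ξ γ τ := by
  rw [angularDeriv, abs_of_pos hτ0]
  rcases lt_or_gt_of_ne hτ with hlt | hgt
  · rw [if_pos hlt, if_pos hlt, angular_of_le (by linarith) (by linarith)]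
    rw [show Real.pi / 2 - (Real.pi / 2 - τ) = τ by ring]
    linear_combination (-ξ * Real.cosh (ξ * τ)) * h.left
  · rw [if_neg hgt.not_gt, if_neg hgt.not_gt, angular_of_abs_le
      (by rw [abs_of_pos (by linarith)]; linarith)]
    rw [show Real.pi / 2 - (Real.pi / 2 - γ) = γ by ring]
    linear_combination (-ξ * Real.sinh (ξ * (Real.pi / 2 - τ))) * h.right

/-- The derivative of the flux is `ξ²` times the profile. -/
theorem Transmission.angularDeriv_conj (h : Transmission ξ γ a b κ) (hγ : 0 < γ)
    (hτ : τ ≠ γ) (hτ0 : 0 < τ) (hτ' : τ < Real.pi / 2) :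
    ξ * κ * angularDeriv ξ (Real.pi / 2 - γ) (Real.pi / 2 - τ) =
      -(ξ ^ 2 * ((if τ < γ then a else b) * angular ξ γ τ)) := by
  rw [angularDeriv, abs_of_pos (by linarith)]
  rcases lt_or_gt_of_ne hτ with hlt | hgt
  · rw [if_pos hlt, if_neg (by linarith), angular_of_abs_le
      (by rw [abs_of_pos hτ0]; linarith)]
    rw [show Real.pi / 2 - (Real.pi / 2 - τ) = τ by ring]
    linear_combination (ξ ^ 2 * Real.sinh (ξ * τ)) * h.left
  · rw [if_neg hgt.not_gt, if_pos (by linarith), angular_of_le hγ.le hgt.le]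
    rw [show Real.pi / 2 - (Real.pi / 2 - γ) = γ by ring]
    linear_combination (-ξ ^ 2 * Real.cosh (ξ * (Real.pi / 2 - τ))) * h.right

end Conjugate

/-! ### The quasi-modes -/

/-- The angles with the two coordinate axes are complementary in each quadrant. -/
theorem elevation_complementary {i j : Fin 2} (hij : i ≠ j) {x : Plane} (hi : x i ≠ 0)
    (hj : x j ≠ 0) : ∃ τ, 0 < τ ∧ τ < Real.pi / 2 ∧ |elevation j x| = τ ∧
      |elevation i x| = Real.pi / 2 - τ ∧ elevation j x = x j / |x j| * τ ∧
      elevation i x = x i / |x i| * (Real.pi / 2 - τ) := by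
  have hx : x ≠ 0 := by rintro rfl; simp at hi
  have hr : 0 < ‖x‖ := norm_pos_iff.2 hx
  have hsq := norm_sq_eq_add_sq hij x
  have hi' : 0 < |x i| := abs_pos.2 hi
  have hj' : 0 < |x j| := abs_pos.2 hj
  have hlt : |x j| / ‖x‖ < 1 := by
    rw [div_lt_one hr]
    refine lt_of_pow_lt_pow_left₀ 2 hr.le ?_
    rw [hsq, sq_abs]
    linarith [pow_pos hi' 2, sq_abs (x i)]
  have hsign : ∀ k : Fin 2, x k ≠ 0 →
      elevation k x = x k / |x k| * Real.arcsin (|x k| / ‖x‖) := fun k hk => by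
    rcases lt_or_gt_of_ne hk with h | h
    · rw [abs_of_neg h, elevation, neg_div, Real.arcsin_neg, div_neg, div_self hk]
      ring
    · rw [abs_of_pos h, elevation, div_self hk, one_mul]
  have hpos : 0 < Real.arcsin (|x j| / ‖x‖) := Real.arcsin_pos.2 (by positivity)
  have hlt2 := Real.arcsin_lt_pi_div_two.2 hlt
  have hcompl : Real.arcsin (|x i| / ‖x‖) = Real.pi / 2 - Real.arcsin (|x j| / ‖x‖) := by
    rw [← Real.arccos_eq_pi_div_two_sub_arcsin, Real.arccos_eq_arcsin (by positivity)]
    congr 1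
    rw [show 1 - (|x j| / ‖x‖) ^ 2 = (|x i| / ‖x‖) ^ 2 by
      rw [div_pow, div_pow, eq_div_iff (by positivity), sub_mul, div_mul_cancel₀ _ (by positivity),
        sq_abs, sq_abs]
      linarith, Real.sqrt_sq (by positivity)]
  refine ⟨Real.arcsin (|x j| / ‖x‖), hpos, hlt2, ?_, ?_, hsign j hj, ?_⟩
  · rw [hsign j hj, abs_mul, abs_div, abs_abs, div_self hj'.ne', one_mul, abs_of_pos hpos]
  · rw [hsign i hi, hcompl, abs_mul, abs_div, abs_abs, div_self hi'.ne', one_mul,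
      abs_of_pos (sub_pos.2 hlt2)]
  · rw [hsign i hi, hcompl]

theorem ae_linear_ne_zero {i j : Fin 2} (hij : i ≠ j) {c d : ℝ} (h : c ≠ 0 ∨ d ≠ 0) :
    ∀ᵐ x : Plane, c * x i + d * x j ≠ 0 := by
  let ℓ : Plane →L[ℝ] ℝ := c • (EuclideanSpace.proj i : Plane →L[ℝ] ℝ) +
    d • (EuclideanSpace.proj j : Plane →L[ℝ] ℝ)
  have hℓ : ∀ x : Plane, ℓ x = c * x i + d * x j := fun x => by simp [ℓ]
  have hker : LinearMap.ker (ℓ : Plane →ₗ[ℝ] ℝ) ≠ ⊤ := fun htop => by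
    have hz : ∀ x, ℓ x = 0 := fun x =>
      LinearMap.mem_ker.1 (htop ▸ Submodule.mem_top : x ∈ LinearMap.ker (ℓ : Plane →ₗ[ℝ] ℝ))
    have h1 := hz (EuclideanSpace.single i 1)
    have h2 := hz (EuclideanSpace.single j 1)
    rw [hℓ] at h1 h2
    simp [hij, hij.symm] at h1 h2
    exact h.elim (· h1) (· h2)
  have := Measure.addHaar_submodule volume _ hker
  rw [ae_iff]
  convert this using 2
  ext x
  simp [← hℓ]

/-- Almost every point lies off the coordinate axes and off the interfaces `|elevation j x| = γ`. -/
theorem ae_off_interfaces {i j : Fin 2} (hij : i ≠ j) {γ : ℝ} (hγ : 0 ≤ γ)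
    (hγ' : γ < Real.pi / 2) :
    ∀ᵐ x : Plane, x i ≠ 0 ∧ x j ≠ 0 ∧ |elevation j x| ≠ γ := by
  have hcos : 0 < Real.cos γ := Real.cos_pos_of_mem_Ioo ⟨by linarith, hγ'⟩
  filter_upwards [ae_linear_ne_zero hij (c := 1) (d := 0) (by simp),
    ae_linear_ne_zero hij (c := 0) (d := 1) (by simp),
    ae_linear_ne_zero hij (c := Real.sin γ) (d := Real.cos γ) (by simp [hcos.ne']),
    ae_linear_ne_zero hij (c := -Real.sin γ) (d := Real.cos γ) (by simp [hcos.ne'])]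
    with x h1 h2 h3 h4
  have hi : x i ≠ 0 := by simpa using h1
  have hj : x j ≠ 0 := by simpa using h2
  refine ⟨hi, hj, fun hγx => ?_⟩
  have hx : x ≠ 0 := by rintro rfl; simp at hi
  have hr : 0 < ‖x‖ := norm_pos_iff.2 hx
  have hsq := norm_sq_eq_add_sq hij x
  have hsin : Real.sin (elevation j x) = x j / ‖x‖ := by
    have habs : |x j / ‖x‖| ≤ 1 := by
      rw [abs_div, abs_norm, div_le_one hr]
      exact PiLp.norm_apply_le x j
    exact Real.sin_arcsin (abs_le.1 habs).1 (abs_le.1 habs).2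
  have hs2 : Real.sin γ ^ 2 * ‖x‖ ^ 2 = x j ^ 2 := by
    have : Real.sin γ ^ 2 = Real.sin (elevation j x) ^ 2 := by
      rw [← hγx]
      rcases abs_choice (elevation j x) with h | h <;> rw [h]
      rw [Real.sin_neg, neg_sq]
    rw [this, hsin, div_pow, div_mul_cancel₀ _ (by positivity)]
  refine mul_ne_zero h3 h4 ?_
  linear_combination (Real.sin γ ^ 2) * hsq - hs2 + x j ^ 2 * Real.sin_sq_add_cos_sq γ

theorem norm_sq_sub_poincareOperator_le {Ω D : Set Plane} (hΩ : Bornology.IsBounded Ω)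
    (hDm : MeasurableSet D) (hD : D ⊆ Ω) (l : ℝ) (i j : Fin 2) (u w : H10 Ω hΩ) :
    ‖(algebraMap ℝ (H10 Ω hΩ →L[ℝ] H10 Ω hΩ) l - poincareOperator hΩ D) u‖ ^ 2 ≤
      ∫ x in Ω, ‖coeff D l x • u.grad x - rot i j (w.grad x)‖ ^ 2 := by
  have he : MemLp (fun x => coeff D l x • u.grad x - rot i j (w.grad x)) 2
      (volume.restrict Ω) := by
    refine MemLp.sub ?_ ((rot i j).comp_memLp' (Lp.memLp w.grad))
    refine (((Lp.memLp u.grad).const_smul l).sub ((Lp.memLp u.grad).indicator hDm)).ae_eq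
      (Eventually.of_forall fun x => ?_)
    by_cases hx : x ∈ D <;> simp [coeff, hx, sub_smul]
  have hle := norm_sub_poincareOperator_le (u := u) (w := w) (i := i) (j := j) (l := l) hΩ hDm hD
    (e := he.toLp) (by
      filter_upwards [he.coeFn_toLp] with x hx
      rw [hx]
      abel)
  refine (pow_le_pow_left₀ (norm_nonneg _) hle 2).trans_eq ?_
  rw [← real_inner_self_eq_norm_sq, L2.inner_def]
  refine integral_congr_ae ?_
  filter_upwards [he.coeFn_toLp] with x hx
  rw [hx, real_inner_self_eq_norm_sq]

theorem H10.norm_sq_eq_integral {Ω : Set Plane} {hΩ : Bornology.IsBounded Ω} (u : H10 Ω hΩ) :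
    ‖u‖ ^ 2 = ∫ x in Ω, ‖u.grad x‖ ^ 2 := by
  rw [← real_inner_self_eq_norm_sq, H10.inner_eq]
  simp only [real_inner_self_eq_norm_sq]

theorem rot_apply_left {i j : Fin 2} (hij : i ≠ j) (v : Plane) : (rot i j v) i = v j := by
  simp [rot, hij]

theorem rot_apply_right {i j : Fin 2} (hij : i ≠ j) (v : Plane) : (rot i j v) j = -v i := by
  simp [rot, hij.symm]

theorem exists_sign_decomposition {p : ℝ} (hp : p ≠ 0) :
    ∃ s m : ℝ, (s = 1 ∨ s = -1) ∧ s ^ 2 = 1 ∧ p = s * m ∧ |p| = m ∧ p / |p| = s := by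
  rcases lt_or_gt_of_ne hp with h | h
  · exact ⟨-1, -p, by simp, by simp, by simp, abs_of_neg h, by
      rw [abs_of_neg h, div_neg, div_self hp]⟩
  · exact ⟨1, p, by simp, by simp, by simp, abs_of_pos h, by rw [abs_of_pos h, div_self hp]⟩

section Pointwise

variable {ξ γ a b κ : ℝ} {i j : Fin 2} {g : ℝ → ℝ} {x : Plane}

theorem norm_sq_gradient_polarFun_angular (hij : i ≠ j) (hg : ContDiff ℝ ∞ g) (hγ : 0 < γ)
    (hi : x i ≠ 0) (hx : |elevation j x| ≠ γ) :
    ‖∇ (polarFun g (angular ξ γ) j) x‖ ^ 2 =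
      (deriv g (Real.log ‖x‖) ^ 2 * angular ξ γ (elevation j x) ^ 2 +
        g (Real.log ‖x‖) ^ 2 * angularDeriv ξ γ (elevation j x) ^ 2) / ‖x‖ ^ 2 := by
  have hx0 : x ≠ 0 := by rintro rfl; simp at hi
  have hr : 0 < ‖x‖ := norm_pos_iff.2 hx0
  have hd : HasDerivAt g (deriv g (Real.log ‖x‖)) (Real.log ‖x‖) :=
    (hg.differentiable (by simp) _).hasDerivAt
  have hG := hasDerivAt_angular (ξ := ξ) hγ.le hx
  have hsq := norm_sq_eq_add_sq hij x
  obtain ⟨s, m, -, hs2, hxi, habs, hdiv⟩ := exists_sign_decomposition hi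
  have hr4 : (‖x‖ ^ 2) ^ 2 = (x i ^ 2 + x j ^ 2) * ‖x‖ ^ 2 := by rw [hsq]; ring
  rw [norm_sq_eq_add_sq hij (∇ (polarFun g (angular ξ γ) j) x), gradient_polarFun_self hij hi hd hG,
    gradient_polarFun_other hij hi hd hG, div_pow, div_pow, ← add_div, div_eq_div_iff
    (by positivity) (by positivity), hr4, hdiv, habs, hxi]
  generalize deriv g (Real.log ‖x‖) = g1
  generalize g (Real.log ‖x‖) = g0
  generalize angular ξ γ (elevation j x) = G
  generalize angularDeriv ξ γ (elevation j x) = G'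
  linear_combination (-(2 * g1 * G * x j * g0 * G' * m + g0 ^ 2 * G' ^ 2 * (m ^ 2 - x j ^ 2)) *
    ‖x‖ ^ 2) * hs2

/-- Off the interfaces, the gradient of the quasi-mode, multiplied by the coefficient, is the
rotated gradient of the conjugate function up to a remainder caused by the radial cutoff. -/
theorem norm_sq_smul_gradient_sub_rot (h : Transmission ξ γ a b κ) (hij : i ≠ j)
    (hg : ContDiff ℝ ∞ g) (hγ : 0 < γ) (hγ' : γ < Real.pi / 2) (hi : x i ≠ 0) (hj : x j ≠ 0)
    (hx : |elevation j x| ≠ γ) :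
    ‖(if |elevation j x| < γ then a else b) • ∇ (polarFun g (angular ξ γ) j) x -
        rot i j (∇ (polarFun (fun s => κ / ξ * deriv g s) (angular ξ (Real.pi / 2 - γ)) i) x)‖ ^ 2 =
      (ξ * κ * angular ξ (Real.pi / 2 - γ) (elevation i x)) ^ 2 *
        (g (Real.log ‖x‖) + deriv (deriv g) (Real.log ‖x‖) / ξ ^ 2) ^ 2 / ‖x‖ ^ 2 := by
  have hx0 : x ≠ 0 := by rintro rfl; simp at hi
  have hr : 0 < ‖x‖ := norm_pos_iff.2 hx0
  have hξ := h.pos.ne'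
  have hd : HasDerivAt g (deriv g (Real.log ‖x‖)) (Real.log ‖x‖) :=
    (hg.differentiable (by simp) _).hasDerivAt
  have hd2 : HasDerivAt (fun s => κ / ξ * deriv g s) (κ / ξ * deriv (deriv g) (Real.log ‖x‖))
      (Real.log ‖x‖) :=
    ((((contDiff_infty_iff_deriv.1 hg).2.differentiable (by simp)) _).hasDerivAt).const_mul _
  obtain ⟨τ, hτ0, hτ', hτ, hτi, htj, hti⟩ := elevation_complementary hij hi hj
  have hx' : |elevation i x| ≠ Real.pi / 2 - γ := by
    rw [hτi]
    exact fun h' => hx (by rw [hτ]; linarith)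
  rw [hτ] at hx ⊢
  have hδ : 0 ≤ Real.pi / 2 - γ := by linarith
  have hG := hasDerivAt_angular (ξ := ξ) hγ.le (hτ.symm ▸ hx : |elevation j x| ≠ γ)
  have hP := hasDerivAt_angular (ξ := ξ) hδ hx'
  have c1 := h.angular_conj hγ' hx hτ0 hτ'
  have c2 := h.angularDeriv_conj hγ hx hτ0 hτ'
  obtain ⟨s, m, hs, hs2, hxi, hmi, hsi⟩ := exists_sign_decomposition hi
  obtain ⟨t, n, ht, ht2, hxj, hnj, htj'⟩ := exists_sign_decomposition hj
  rw [hsi] at hti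
  rw [htj'] at htj
  -- parity of the profiles
  have e1 : angular ξ γ (elevation j x) = t * angular ξ γ τ := by
    rw [htj]
    rcases ht with rfl | rfl
    · simp
    · simp [angular_neg hγ.le]
  have e2 : angularDeriv ξ γ (elevation j x) = angularDeriv ξ γ τ := by
    rw [htj]
    rcases ht with rfl | rfl
    · simp
    · simp [angularDeriv_neg]
  have e3 : angular ξ (Real.pi / 2 - γ) (elevation i x) =
      s * angular ξ (Real.pi / 2 - γ) (Real.pi / 2 - τ) := by
    rw [hti]
    rcases hs with rfl | rfl
    · simp
    · rw [neg_one_mul, angular_neg hδ, neg_one_mul]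
  have e4 : angularDeriv ξ (Real.pi / 2 - γ) (elevation i x) =
      angularDeriv ξ (Real.pi / 2 - γ) (Real.pi / 2 - τ) := by
    rw [hti]
    rcases hs with rfl | rfl
    · simp
    · rw [neg_one_mul, angularDeriv_neg]
  have hsq := norm_sq_eq_add_sq hij x
  rw [norm_sq_eq_add_sq hij, PiLp.sub_apply, PiLp.sub_apply, PiLp.smul_apply, PiLp.smul_apply,
    rot_apply_left hij, rot_apply_right hij, gradient_polarFun_self hij hi hd hG,
    gradient_polarFun_other hij hi hd hG, gradient_polarFun_self hij.symm hj hd2 hP,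
    gradient_polarFun_other hij.symm hj hd2 hP, e1, e2, e3, e4, hsi, htj', hmi, hnj]
  rw [hxi, hxj] at hsq
  rw [hxi, hxj]
  simp only [smul_eq_mul]
  generalize (if τ < γ then a else b) = A at *
  generalize deriv g (Real.log ‖x‖) = g1
  generalize g (Real.log ‖x‖) = g0
  obtain ⟨q, hq⟩ : ∃ q, deriv (deriv g) (Real.log ‖x‖) = ξ ^ 2 * q :=
    ⟨deriv (deriv g) (Real.log ‖x‖) / ξ ^ 2, by field_simp⟩
  obtain ⟨η, hη⟩ : ∃ η, κ = η * ξ := ⟨κ / ξ, by field_simp⟩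
  rw [hq, mul_div_cancel_left₀ _ (pow_ne_zero 2 hξ)]
  subst hη
  rw [mul_div_cancel_right₀ _ hξ]
  generalize angular ξ γ τ = G at *
  generalize angularDeriv ξ γ τ = G' at *
  generalize angular ξ (Real.pi / 2 - γ) (Real.pi / 2 - τ) = P at *
  generalize angularDeriv ξ (Real.pi / 2 - γ) (Real.pi / 2 - τ) = P' at *
  have c2' : η * P' = -(A * G) :=
    mul_left_cancel₀ (pow_ne_zero 2 hξ) (by linear_combination c2)
  have E1 : A * (g1 * (t * G) * (s * m) - g0 * G' * s * (t * n)) -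
      (η * (ξ ^ 2 * q) * (s * P) * (t * n) - η * g1 * P' * t * (s * m)) =
      -(ξ * (η * ξ) * (s * P)) * (g0 + q) * (t * n) := by
    linear_combination (g1 * t * s * m) * c2' + (g0 * s * t * n) * c1
  have E2 : A * (g1 * (t * G) * (t * n) + g0 * G' * m) +
      (η * (ξ ^ 2 * q) * (s * P) * (s * m) + η * g1 * P' * n) =
      (ξ * (η * ξ) * (s * P)) * (g0 + q) * (s * m) := by
    linear_combination (g1 * n) * c2' + (A * G * g1 * n) * ht2 - (g0 * m * s ^ 2) * c1 -
      (A * G' * g0 * m) * hs2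
  have F1 := congrArg (· / ‖x‖ ^ 2) E1
  have F2 := congrArg (· / ‖x‖ ^ 2) E2
  calc _ = ((A * (g1 * (t * G) * (s * m) - g0 * G' * s * (t * n)) -
      (η * (ξ ^ 2 * q) * (s * P) * (t * n) - η * g1 * P' * t * (s * m))) / ‖x‖ ^ 2) ^ 2 +
      ((A * (g1 * (t * G) * (t * n) + g0 * G' * m) +
      (η * (ξ ^ 2 * q) * (s * P) * (s * m) + η * g1 * P' * n)) / ‖x‖ ^ 2) ^ 2 := by ring
    _ = (ξ * (η * ξ) * (s * P)) ^ 2 * (g0 + q) ^ 2 * ((s * m) ^ 2 + (t * n) ^ 2) /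
        (‖x‖ ^ 2) ^ 2 := by rw [F1, F2]; ring
    _ = _ := by rw [← hsq]; field_simp

end Pointwise

/-! ### The bowtie near its vertex -/

theorem polar_coordinates (x : Plane) (hx : x ≠ 0) :
    x 1 = ‖x‖ * Real.sin (elevation 1 x) ∧ |x 0| = ‖x‖ * Real.cos (elevation 1 x) := by
  have hr : 0 < ‖x‖ := norm_pos_iff.2 hx
  have habs : |x 1 / ‖x‖| ≤ 1 := by
    rw [abs_div, abs_norm, div_le_one hr]
    exact PiLp.norm_apply_le x 1
  have hsin : Real.sin (elevation 1 x) = x 1 / ‖x‖ :=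
    Real.sin_arcsin (abs_le.1 habs).1 (abs_le.1 habs).2
  refine ⟨by rw [hsin, mul_div_cancel₀ _ hr.ne'], ?_⟩
  have hsq := norm_sq_eq_add_sq zero_ne_one x
  rw [elevation, Real.cos_arcsin, ← Real.sqrt_sq_eq_abs, ← Real.sqrt_sq hr.le,
    ← Real.sqrt_mul (sq_nonneg _), Real.sqrt_sq hr.le]
  congr 1
  field_simp
  linarith

theorem norm_polar {r : ℝ} (hr : 0 < r) (θ : ℝ) :
    ‖(!₂[r * Real.cos θ, r * Real.sin θ] : Plane)‖ = r := by
  rw [EuclideanSpace.norm_eq, Fin.sum_univ_two]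
  simp only [Real.norm_eq_abs, sq_abs, Matrix.cons_val_zero, Matrix.cons_val_one]
  rw [show (r * Real.cos θ) ^ 2 + (r * Real.sin θ) ^ 2 = r ^ 2 by
    linear_combination r ^ 2 * Real.sin_sq_add_cos_sq θ, Real.sqrt_sq hr.le]

theorem elevation_polar {r : ℝ} (hr : 0 < r) (θ : ℝ) :
    elevation 1 (!₂[r * Real.cos θ, r * Real.sin θ] : Plane) = Real.arcsin (Real.sin θ) := by
  rw [elevation, norm_polar hr]
  simp [hr.ne']

theorem IsBowtie.exists_mem_iff {D : Set Plane} {α : ℝ} (hD : IsBowtie D α) :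
    ∃ r₀ > 0, ∀ x : Plane, x ≠ 0 → ‖x‖ < r₀ → (x ∈ D ↔ |elevation 1 x| < α / 2) := by
  obtain ⟨hα, hαπ, r₀, D₁, D₂, hr₀, h1, h2, rfl⟩ := hD
  refine ⟨r₀, hr₀, fun x hx hxr => ?_⟩
  have hr : 0 < ‖x‖ := norm_pos_iff.2 hx
  have hball : x ∈ Metric.ball (0 : Plane) r₀ := mem_ball_zero_iff.2 hxr
  have e1 : x ∈ D₁ ↔ x ∈ sector r₀ α 0 := by rw [← h1.inter_ball]; simp [hxr]
  have e2 : x ∈ D₂ ↔ x ∈ sector r₀ α Real.pi := by rw [← h2.inter_ball]; simp [hxr]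
  rw [mem_union, e1, e2]
  constructor
  · rintro (⟨r, θ, hr0, -, hθ1, hθ2, rfl⟩ | ⟨r, θ, hr0, -, hθ1, hθ2, rfl⟩)
    · rw [elevation_polar hr0, Real.arcsin_sin (by linarith) (by linarith), abs_lt]
      constructor <;> linarith
    · rw [elevation_polar hr0, ← Real.sin_pi_sub, Real.arcsin_sin (by linarith) (by linarith),
        abs_lt]
      constructor <;> linarith
  · intro hlt
    obtain ⟨hl1, hl2⟩ := abs_lt.1 hlt
    obtain ⟨p1, p0⟩ := polar_coordinates x hx
    have hext : ∀ θ, x 0 = ‖x‖ * Real.cos θ → x 1 = ‖x‖ * Real.sin θ →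
        x = !₂[‖x‖ * Real.cos θ, ‖x‖ * Real.sin θ] := fun θ h0 h1 => by
      ext k
      fin_cases k
      · exact h0
      · exact h1
    rcases le_total 0 (x 0) with h | h
    · left
      rw [abs_of_nonneg h] at p0
      exact ⟨‖x‖, elevation 1 x, hr, hxr, by linarith, by linarith, hext _ p0 p1⟩
    · right
      rw [abs_of_nonpos h] at p0
      refine ⟨‖x‖, Real.pi - elevation 1 x, hr, hxr, by linarith, by linarith, hext _ ?_ ?_⟩
      · rw [Real.cos_pi_sub]
        linarith
      · rw [Real.sin_pi_sub, p1]

/-! ### Radial integrals -/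

section Radial

variable {Ω : Set Plane} {F : ℝ → ℝ} {a : ℝ}

/-- A radial function given by a compactly supported function of `log r` vanishes near `0`. -/
theorem exists_radial_vanish (ha : a < 0) (hFc : HasCompactSupport F) (hFa : tsupport F ⊆ Iic a) :
    ∃ b, ∀ r : ℝ, 0 ≤ r → (r ≤ Real.exp b ∨ Real.exp a < r) → F (Real.log r) = 0 := by
  obtain ⟨b, hb⟩ := hFc.isCompact.bddBelow
  refine ⟨b - 1, fun r hr h => ?_⟩
  by_contra hne
  have hmem := subset_tsupport F hne
  have hlog : Real.log r ≤ a := hFa hmem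
  have hr0 : 0 < r := by
    refine hr.lt_of_ne' fun h0 => ?_
    rw [h0, Real.log_zero] at hlog
    linarith
  rcases h with h | h
  · have h1 := (Real.log_le_iff_le_exp hr0).2 h
    linarith [hb hmem]
  · exact h.not_ge ((Real.log_le_iff_le_exp hr0).1 hlog)

theorem integrable_radial (hΩ : Bornology.IsBounded Ω) (hF : Continuous F) (ha : a < 0)
    (hFc : HasCompactSupport F) (hFa : tsupport F ⊆ Iic a) :
    Integrable (fun x : Plane => F (Real.log ‖x‖) / ‖x‖ ^ 2) (volume.restrict Ω) := by
  have : IsFiniteMeasure (volume.restrict Ω) := ⟨by simpa using hΩ.measure_lt_top⟩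
  obtain ⟨M, hM⟩ := hFc.exists_bound_of_continuous hF
  obtain ⟨b, hb⟩ := exists_radial_vanish ha hFc hFa
  have hM0 : 0 ≤ M := (norm_nonneg _).trans (hM 0)
  refine Integrable.of_bound (C := M / Real.exp b ^ 2) ?_ (Eventually.of_forall fun x => ?_)
  · exact ((hF.measurable.comp (Real.measurable_log.comp measurable_norm)).div
      (measurable_norm.pow_const 2)).aestronglyMeasurable
  · rcases le_or_gt ‖x‖ (Real.exp b) with h | h
    · rw [hb _ (norm_nonneg x) (Or.inl h), zero_div, norm_zero]
      positivity
    · rw [norm_div, norm_pow, norm_norm]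
      gcongr
      exact hM _

theorem integral_radial (ha : a < 0) (hFc : HasCompactSupport F)
    (hFa : tsupport F ⊆ Iic a) (hball : Metric.closedBall 0 (Real.exp a) ⊆ Ω) :
    ∫ x in Ω, F (Real.log ‖x‖) / ‖x‖ ^ 2 =
      2 * volume.real (Metric.ball (0 : Plane) 1) * ∫ s, F s := by
  obtain ⟨b, hb⟩ := exists_radial_vanish ha hFc hFa
  rw [setIntegral_eq_integral_of_forall_compl_eq_zero fun x hx => by
    rw [hb _ (norm_nonneg x) (Or.inr (by
      by_contra h
      exact hx (hball (mem_closedBall_zero_iff.2 (not_lt.1 h))))), zero_div],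
    integral_fun_norm_addHaar volume fun r => F (Real.log r) / r ^ 2]
  have hdim : Module.finrank ℝ Plane = 2 := by simp
  have h1 : ∫ y in Ioi (0 : ℝ), y ^ (Module.finrank ℝ Plane - 1) • (F (Real.log y) / y ^ 2) =
      ∫ y in Ioi (Real.exp b), y⁻¹ • F (Real.log y) := by
    rw [hdim]
    have hsub : Ioi (Real.exp b) ⊆ Ioi (0 : ℝ) := Ioi_subset_Ioi (Real.exp_pos b).le
    rw [← setIntegral_eq_of_subset_of_forall_sdiff_eq_zero measurableSet_Ioi hsub]
    · refine setIntegral_congr_fun measurableSet_Ioi fun y hy => ?_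
      have hy0 : y ≠ 0 := (mem_Ioi.1 hy).ne'
      simp only [smul_eq_mul]
      field_simp
      norm_num [mul_comm]
    · rintro y ⟨hy, hy'⟩
      simp only [mem_Ioi, not_lt] at hy hy'
      rw [hb _ hy.le (Or.inl hy'), smul_zero]
  rw [h1, integral_comp_log_Ioi F (Real.exp_pos b), Real.log_exp,
    setIntegral_eq_integral_of_forall_compl_eq_zero, hdim]
  · simp only [smul_eq_mul, nsmul_eq_mul]
    push_cast
    ring
  · intro s hs
    rw [mem_Ioi, not_lt] at hs
    have := hb (Real.exp s) (Real.exp_pos s).le (Or.inl (Real.exp_le_exp.2 hs))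
    rwa [Real.log_exp] at this

end Radial

/-! ### Weyl sequences -/

section Weyl

variable {Ω D : Set Plane} {ξ γ p q κ a l K M : ℝ} {i j : Fin 2} {g : ℝ → ℝ}

/-- The energy of the quasi-mode with radial factor `g` is controlled by the remainder, if
`l - T_D` is bounded below by `1 / K`. -/
theorem integral_energy_le (hΩ : Bornology.IsBounded Ω) (hΩo : IsOpen Ω)
    (hDm : MeasurableSet D) (hD : D ⊆ Ω) (h : Transmission ξ γ p q κ) (hij : i ≠ j)
    (hγ : 0 < γ) (hγ' : γ < Real.pi / 2) (ha : a < 0)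
    (hball : Metric.closedBall 0 (Real.exp a) ⊆ Ω)
    (hcoeff : ∀ x : Plane, ‖x‖ ≤ Real.exp a → x i ≠ 0 → x j ≠ 0 → |elevation j x| ≠ γ →
      coeff D l x = if |elevation j x| < γ then p else q)
    (hK : ∀ u : H10 Ω hΩ, ‖u‖ ≤
      K * ‖(algebraMap ℝ (H10 Ω hΩ →L[ℝ] H10 Ω hΩ) l - poincareOperator hΩ D) u‖)
    (hM : ∀ t ∈ Icc (-(Real.pi / 2)) (Real.pi / 2), |ξ * κ * angular ξ (Real.pi / 2 - γ) t| ≤ M)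
    (hg : ContDiff ℝ ∞ g) (hgc : HasCompactSupport g) (hga : tsupport g ⊆ Iic a) :
    Integrable (fun x : Plane => (deriv g (Real.log ‖x‖) ^ 2 * angular ξ γ (elevation j x) ^ 2 +
        g (Real.log ‖x‖) ^ 2 * angularDeriv ξ γ (elevation j x) ^ 2) / ‖x‖ ^ 2)
      (volume.restrict Ω) ∧
    ∫ x in Ω, (deriv g (Real.log ‖x‖) ^ 2 * angular ξ γ (elevation j x) ^ 2 +
        g (Real.log ‖x‖) ^ 2 * angularDeriv ξ γ (elevation j x) ^ 2) / ‖x‖ ^ 2 ≤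
      K ^ 2 * M ^ 2 * (2 * volume.real (Metric.ball (0 : Plane) 1) *
        ∫ s, (g s + deriv (deriv g) s / ξ ^ 2) ^ 2) := by
  set f := polarFun g (angular ξ γ) j with hf
  have hdg : ContDiff ℝ ∞ (deriv g) := (contDiff_infty_iff_deriv.1 hg).2
  have hddg : ContDiff ℝ ∞ (deriv (deriv g)) := (contDiff_infty_iff_deriv.1 hdg).2
  have hdga : tsupport (deriv g) ⊆ Iic a := (closure_minimal
    support_deriv_subset (isClosed_tsupport g)).trans hga
  have hddga : tsupport (deriv (deriv g)) ⊆ Iic a := (closure_minimal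
    support_deriv_subset (isClosed_tsupport _)).trans hdga
  have hδ : 0 ≤ Real.pi / 2 - γ := by linarith
  have hhs : ContDiff ℝ ∞ fun s => κ / ξ * deriv g s := contDiff_const.mul hdg
  have hhc : HasCompactSupport fun s => κ / ξ * deriv g s := hgc.deriv.mul_left
  have hha : tsupport (fun s => κ / ξ * deriv g s) ⊆ Iic a :=
    (tsupport_mul_subset_right (f := fun _ => κ / ξ)).trans hdga
  set fw := polarFun (fun s => κ / ξ * deriv g s) (angular ξ (Real.pi / 2 - γ)) i with hfw
  obtain ⟨K₁, hK₁⟩ := exists_lipschitzOnWith_angular ξ hγ.le hγ'.le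
  obtain ⟨K₂, hK₂⟩ := exists_lipschitzOnWith_angular ξ hδ (by linarith)
  obtain ⟨C₁, hC₁⟩ := exists_lipschitzWith_polarFun ha hga hg hgc hK₁ j
  obtain ⟨C₂, hC₂⟩ := exists_lipschitzWith_polarFun ha hha hhs hhc hK₂ i
  obtain ⟨u, hu⟩ := exists_H10_of_lipschitzWith hΩ hΩo hC₁ (hasCompactSupport_polarFun ha hga j)
    ((tsupport_polarFun_subset ha hga j).trans hball)
  obtain ⟨w, hw⟩ := exists_H10_of_lipschitzWith hΩ hΩo hC₂ (hasCompactSupport_polarFun ha hha i)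
    ((tsupport_polarFun_subset ha hha i).trans hball)
  have hoff : ∀ᵐ x ∂(volume.restrict Ω), x i ≠ 0 ∧ x j ≠ 0 ∧ |elevation j x| ≠ γ :=
    ae_restrict_of_ae (ae_off_interfaces hij hγ.le hγ')
  have henergy : (fun x => ‖u.grad x‖ ^ 2) =ᵐ[volume.restrict Ω] fun x : Plane =>
      (deriv g (Real.log ‖x‖) ^ 2 * angular ξ γ (elevation j x) ^ 2 +
        g (Real.log ‖x‖) ^ 2 * angularDeriv ξ γ (elevation j x) ^ 2) / ‖x‖ ^ 2 := by
    filter_upwards [hu, hoff] with x hx ⟨hi, hj, hγx⟩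
    rw [hx]
    exact norm_sq_gradient_polarFun_angular hij hg hγ hi hγx
  have hintE : Integrable (fun x => ‖u.grad x‖ ^ 2) (volume.restrict Ω) :=
    (Lp.memLp u.grad).integrable_norm_pow (by simp)
  refine ⟨hintE.congr henergy, ?_⟩
  set F : ℝ → ℝ := fun s => (g s + deriv (deriv g) s / ξ ^ 2) ^ 2 with hF
  have hFcont : Continuous F :=
    (hg.continuous.add (hddg.continuous.div_const _)).pow 2
  have hF0 : ∀ s, s ∉ tsupport g → F s = 0 := fun s hs => by
    have h1 : g s = 0 := image_eq_zero_of_notMem_tsupport hs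
    have h2 : deriv (deriv g) s = 0 := by
      refine image_eq_zero_of_notMem_tsupport fun h' => hs ?_
      exact (closure_minimal support_deriv_subset (isClosed_tsupport g))
        ((closure_minimal support_deriv_subset (isClosed_tsupport _)) h')
    simp [hF, h1, h2]
  have hFsub : tsupport F ⊆ tsupport g :=
    closure_minimal (fun s hs => by_contra fun h' => hs (hF0 s h')) (isClosed_tsupport g)
  have hFc : HasCompactSupport F := HasCompactSupport.of_support_subset_isCompact hgc.isCompact
    ((subset_tsupport F).trans hFsub)
  have hres : ∀ᵐ x ∂(volume.restrict Ω), ‖coeff D l x • u.grad x - rot i j (w.grad x)‖ ^ 2 ≤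
      M ^ 2 * (F (Real.log ‖x‖) / ‖x‖ ^ 2) := by
    filter_upwards [hu, hw, hoff] with x hux hwx ⟨hi, hj, hγx⟩
    have hmain := norm_sq_smul_gradient_sub_rot h hij hg hγ hγ' hi hj hγx
    have hMx : (ξ * κ * angular ξ (Real.pi / 2 - γ) (elevation i x)) ^ 2 ≤ M ^ 2 :=
      sq_le_sq' (neg_le_of_abs_le (hM _ (elevation_mem_Icc i x)))
        (le_of_abs_le (hM _ (elevation_mem_Icc i x)))
    have hswitch : coeff D l x • ∇ f x = (if |elevation j x| < γ then p else q) • ∇ f x := by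
      rcases le_or_gt ‖x‖ (Real.exp a) with hxa | hxa
      · rw [hcoeff x hxa hi hj hγx]
      · have hz : ∇ f x = 0 := by
          have hnot : x ∉ tsupport f := fun h' => hxa.not_ge
            (mem_closedBall_zero_iff.1 (tsupport_polarFun_subset ha hga j h'))
          rw [gradient, fderiv_of_notMem_tsupport ℝ hnot, map_zero]
        rw [hz, smul_zero, smul_zero]
    rw [hux, hwx, hswitch, hmain, mul_div_assoc]
    exact mul_le_mul_of_nonneg_right hMx (by positivity)
  have hradint : Integrable (fun x : Plane => F (Real.log ‖x‖) / ‖x‖ ^ 2) (volume.restrict Ω) :=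
    integrable_radial hΩ hFcont ha hFc (hFsub.trans hga)
  calc _ = ‖u‖ ^ 2 := by rw [H10.norm_sq_eq_integral, integral_congr_ae henergy]
    _ ≤ (K * ‖(algebraMap ℝ (H10 Ω hΩ →L[ℝ] H10 Ω hΩ) l - poincareOperator hΩ D) u‖) ^ 2 :=
        pow_le_pow_left₀ (norm_nonneg _) (hK u) 2
    _ = K ^ 2 * ‖(algebraMap ℝ (H10 Ω hΩ →L[ℝ] H10 Ω hΩ) l - poincareOperator hΩ D) u‖ ^ 2 := by
        ring
    _ ≤ K ^ 2 * ∫ x in Ω, ‖coeff D l x • u.grad x - rot i j (w.grad x)‖ ^ 2 := by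
        gcongr
        exact norm_sq_sub_poincareOperator_le hΩ hDm hD l i j u w
    _ ≤ K ^ 2 * ∫ x in Ω, M ^ 2 * (F (Real.log ‖x‖) / ‖x‖ ^ 2) := by
        refine mul_le_mul_of_nonneg_left ?_ (sq_nonneg K)
        exact integral_mono_of_nonneg (Eventually.of_forall fun x => sq_nonneg _)
          (hradint.const_mul _) hres
    _ = _ := by
        rw [integral_const_mul, integral_radial ha hFc (hFsub.trans hga) hball]
        ring

end Weyl

section Modulation

variable {χ : ℝ → ℝ} {ξ θ s : ℝ}

/-- A cutoff `χ` modulated at frequency `ξ` with phase `θ`. -/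
noncomputable def modulated (χ : ℝ → ℝ) (ξ θ s : ℝ) : ℝ := χ s * Real.cos (ξ * s + θ)

theorem contDiff_modulated (hχ : ContDiff ℝ ∞ χ) : ContDiff ℝ ∞ (modulated χ ξ θ) :=
  hχ.mul (Real.contDiff_cos.comp (by fun_prop))

theorem hasDerivAt_phase (ξ θ s : ℝ) : HasDerivAt (fun s => ξ * s + θ) ξ s := by
  simpa using ((hasDerivAt_id s).const_mul ξ).add_const θ

theorem deriv_modulated (hχ : ContDiff ℝ ∞ χ) : deriv (modulated χ ξ θ) =
    fun s => deriv χ s * Real.cos (ξ * s + θ) - ξ * (χ s * Real.sin (ξ * s + θ)) := by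
  ext s
  have h1 := ((hχ.differentiable (by simp) s).hasDerivAt).mul (hasDerivAt_phase ξ θ s).cos
  exact h1.deriv.trans (by ring)

theorem deriv_deriv_modulated (hχ : ContDiff ℝ ∞ χ) (s : ℝ) :
    deriv (deriv (modulated χ ξ θ)) s = deriv (deriv χ) s * Real.cos (ξ * s + θ) -
      2 * ξ * deriv χ s * Real.sin (ξ * s + θ) - ξ ^ 2 * modulated χ ξ θ s := by
  rw [deriv_modulated hχ]
  have hd : ContDiff ℝ ∞ (deriv χ) := (contDiff_infty_iff_deriv.1 hχ).2
  have h1 := ((hd.differentiable (by simp) s).hasDerivAt).mul (hasDerivAt_phase ξ θ s).cos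
  have h2 := ((hχ.differentiable (by simp) s).hasDerivAt).mul (hasDerivAt_phase ξ θ s).sin
  refine (h1.sub (h2.const_mul ξ)).deriv.trans ?_
  rw [modulated]
  ring

end Modulation

section Cutoff

variable {Ω D : Set Plane} {ξ γ p q κ a l : ℝ} {i j : Fin 2}

/-- If `l` is not in the spectrum, all cutoffs supported in `(-∞, a]` satisfy a Poincaré type
inequality; it is obtained by adding the energy estimates of two quasi-modes in quadrature, for
which the oscillating factors disappear. -/
theorem exists_cutoff_inequality (hΩ : Bornology.IsBounded Ω) (hΩo : IsOpen Ω)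
    (hDm : MeasurableSet D) (hD : D ⊆ Ω) (h : Transmission ξ γ p q κ) (hij : i ≠ j)
    (hγ : 0 < γ) (hγ' : γ < Real.pi / 2) (ha : a < 0)
    (hball : Metric.closedBall 0 (Real.exp a) ⊆ Ω)
    (hcoeff : ∀ x : Plane, ‖x‖ ≤ Real.exp a → x i ≠ 0 → x j ≠ 0 → |elevation j x| ≠ γ →
      coeff D l x = if |elevation j x| < γ then p else q)
    (hl : l ∉ spectrum ℝ (poincareOperator hΩ D)) :
    ∃ C : ℝ, ∀ χ : ℝ → ℝ, ContDiff ℝ ∞ χ → HasCompactSupport χ → tsupport χ ⊆ Iic a →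
      ∫ s, χ s ^ 2 ≤ C * ∫ s, (deriv (deriv χ) s ^ 2 + 4 * ξ ^ 2 * deriv χ s ^ 2) := by
  obtain ⟨K, -, hK⟩ := exists_bound_of_notMem_spectrum hl
  obtain ⟨c, hc, hcE⟩ := exists_angular_energy_ge h.pos hγ
  obtain ⟨L, hL⟩ := exists_lipschitzOnWith_angular ξ (γ := Real.pi / 2 - γ) (by linarith)
    (by linarith)
  obtain ⟨M, hM⟩ := isCompact_Icc.exists_bound_of_continuousOn
    (hL.continuousOn.const_mul (ξ * κ))
  have hξ := h.pos.ne'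
  have hvol : 0 < volume.real (Metric.ball (0 : Plane) 1) :=
    ENNReal.toReal_pos (Metric.measure_ball_pos _ _ one_pos).ne' measure_ball_lt_top.ne
  refine ⟨K ^ 2 * M ^ 2 / (c * ξ ^ 4), fun χ hχ hχc hχa => ?_⟩
  have hd : ContDiff ℝ ∞ (deriv χ) := (contDiff_infty_iff_deriv.1 hχ).2
  have hdd : ContDiff ℝ ∞ (deriv (deriv χ)) := (contDiff_infty_iff_deriv.1 hd).2
  have hmod : ∀ θ, tsupport (modulated χ ξ θ) ⊆ Iic a := fun θ =>
    tsupport_mul_subset_left.trans hχa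
  have est := fun θ => integral_energy_le hΩ hΩo hDm hD h hij hγ hγ' ha hball hcoeff hK hM
    (contDiff_modulated (ξ := ξ) (θ := θ) hχ) hχc.mul_right (hmod θ)
  -- the phases `0` and `-π/2` give the factors `cos (ξ s)` and `sin (ξ s)`
  obtain ⟨i1, e1⟩ := est 0
  obtain ⟨i2, e2⟩ := est (-(Real.pi / 2))
  have htrig : ∀ x : ℝ, Real.cos (x + -(Real.pi / 2)) = Real.sin x ∧
      Real.sin (x + -(Real.pi / 2)) = -Real.cos x := fun x =>
    ⟨by rw [← sub_eq_add_neg, Real.cos_sub_pi_div_two],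
      by rw [← sub_eq_add_neg, Real.sin_sub_pi_div_two]⟩
  have hsq : HasCompactSupport fun s => χ s ^ 2 := hχc.comp_left (g := fun t : ℝ => t ^ 2) (by simp)
  have hsqa : tsupport (fun s => χ s ^ 2) ⊆ Iic a :=
    (closure_minimal (fun s hs => subset_tsupport χ fun h0 =>
      (Function.mem_support.1 hs) (by simp [h0])) (isClosed_tsupport χ)).trans hχa
  have hlow : c * (2 * volume.real (Metric.ball (0 : Plane) 1) * ∫ s, χ s ^ 2) ≤
      ∫ x in Ω, ((deriv (modulated χ ξ 0) (Real.log ‖x‖) ^ 2 * angular ξ γ (elevation j x) ^ 2 +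
        modulated χ ξ 0 (Real.log ‖x‖) ^ 2 * angularDeriv ξ γ (elevation j x) ^ 2) / ‖x‖ ^ 2 +
        (deriv (modulated χ ξ (-(Real.pi / 2))) (Real.log ‖x‖) ^ 2 *
          angular ξ γ (elevation j x) ^ 2 +
        modulated χ ξ (-(Real.pi / 2)) (Real.log ‖x‖) ^ 2 *
          angularDeriv ξ γ (elevation j x) ^ 2) / ‖x‖ ^ 2) := by
    rw [← integral_radial ha hsq hsqa hball, ← integral_const_mul]
    refine integral_mono_of_nonneg (Eventually.of_forall fun x => by positivity) (i1.add i2)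
      (Eventually.of_forall fun x => ?_)
    simp only [deriv_modulated hχ, modulated, htrig, add_zero]
    set s := Real.log ‖x‖
    rw [← add_div, ← mul_div_assoc]
    refine div_le_div_of_nonneg_right ?_ (sq_nonneg _)
    have hcs := Real.sin_sq_add_cos_sq (ξ * s)
    have hE := mul_le_mul_of_nonneg_left (hcE (elevation j x)) (sq_nonneg (χ s))
    have hd2 : 0 ≤ deriv χ s ^ 2 * angular ξ γ (elevation j x) ^ 2 := by positivity
    calc c * χ s ^ 2 ≤ χ s ^ 2 * (ξ ^ 2 * angular ξ γ (elevation j x) ^ 2 +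
          angularDeriv ξ γ (elevation j x) ^ 2) +
          deriv χ s ^ 2 * angular ξ γ (elevation j x) ^ 2 := by linarith
      _ = _ := by
        linear_combination (-(χ s ^ 2 * (ξ ^ 2 * angular ξ γ (elevation j x) ^ 2 +
          angularDeriv ξ γ (elevation j x) ^ 2) +
          deriv χ s ^ 2 * angular ξ γ (elevation j x) ^ 2)) * hcs
  rw [integral_add i1 i2] at hlow
  have hcont : ∀ θ, Continuous fun s =>
      (modulated χ ξ θ s + deriv (deriv (modulated χ ξ θ)) s / ξ ^ 2) ^ 2 := fun θ => by
    have h1 : ContDiff ℝ ∞ (modulated χ ξ θ) := contDiff_modulated hχ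
    have h2 : ContDiff ℝ ∞ (deriv (deriv (modulated χ ξ θ))) :=
      (contDiff_infty_iff_deriv.1 (contDiff_infty_iff_deriv.1 h1).2).2
    exact (h1.continuous.add (h2.continuous.div_const _)).pow 2
  have hrem : ∀ θ s, modulated χ ξ θ s + deriv (deriv (modulated χ ξ θ)) s / ξ ^ 2 =
      (deriv (deriv χ) s * Real.cos (ξ * s + θ) -
        2 * ξ * deriv χ s * Real.sin (ξ * s + θ)) / ξ ^ 2 := fun θ s => by
    rw [deriv_deriv_modulated hχ]
    field_simp
    ring
  have hint : ∀ θ, Integrable fun s =>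
      (modulated χ ξ θ s + deriv (deriv (modulated χ ξ θ)) s / ξ ^ 2) ^ 2 := fun θ => by
    refine (hcont θ).integrable_of_hasCompactSupport ?_
    refine HasCompactSupport.of_support_subset_isCompact hχc.isCompact fun s hs => ?_
    by_contra hnot
    have h1 : deriv χ s = 0 := image_eq_zero_of_notMem_tsupport fun h' =>
      hnot (closure_minimal support_deriv_subset (isClosed_tsupport χ) h')
    have h2 : deriv (deriv χ) s = 0 := image_eq_zero_of_notMem_tsupport fun h' =>
      hnot (closure_minimal support_deriv_subset (isClosed_tsupport χ)
        (closure_minimal support_deriv_subset (isClosed_tsupport _) h'))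
    exact hs (by simp [hrem, h1, h2])
  have hsum : (∫ s, (modulated χ ξ 0 s + deriv (deriv (modulated χ ξ 0)) s / ξ ^ 2) ^ 2) +
      ∫ s, (modulated χ ξ (-(Real.pi / 2)) s +
        deriv (deriv (modulated χ ξ (-(Real.pi / 2)))) s / ξ ^ 2) ^ 2 =
      (ξ ^ 4)⁻¹ * ∫ s, (deriv (deriv χ) s ^ 2 + 4 * ξ ^ 2 * deriv χ s ^ 2) := by
    rw [← integral_add (hint _) (hint _), ← integral_const_mul]
    congr 1
    ext s
    rw [hrem, hrem, (htrig _).1, (htrig _).2, add_zero]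
    field_simp
    linear_combination (deriv (deriv χ) s ^ 2 + 4 * ξ ^ 2 * deriv χ s ^ 2) *
      Real.sin_sq_add_cos_sq (ξ * s)
  set V := 2 * volume.real (Metric.ball (0 : Plane) 1)
  have hV : 0 < V := by positivity
  have hfin : V * (c * ∫ s, χ s ^ 2) ≤ V * (K ^ 2 * M ^ 2 * ((ξ ^ 4)⁻¹ *
      ∫ s, (deriv (deriv χ) s ^ 2 + 4 * ξ ^ 2 * deriv χ s ^ 2))) := by
    rw [← hsum]
    linarith
  have hfin2 := le_of_mul_le_mul_left hfin hV
  rw [div_mul_eq_mul_div, le_div_iff₀ (by have := h.pos; positivity)]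
  calc (∫ s, χ s ^ 2) * (c * ξ ^ 4) = ξ ^ 4 * (c * ∫ s, χ s ^ 2) := by ring
    _ ≤ ξ ^ 4 * (K ^ 2 * M ^ 2 * ((ξ ^ 4)⁻¹ *
      ∫ s, (deriv (deriv χ) s ^ 2 + 4 * ξ ^ 2 * deriv χ s ^ 2))) := by gcongr
    _ = _ := by field_simp

theorem integrable_sq_of_hasCompactSupport {F : ℝ → ℝ} (hF : Continuous F)
    (hFc : HasCompactSupport F) : Integrable fun s => F s ^ 2 := by
  simp only [sq]
  exact (hF.mul hF).integrable_of_hasCompactSupport hFc.mul_right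

/-- Spreading out a bump over a long interval contradicts any inequality bounding a cutoff by its
derivatives. -/
theorem not_cutoff_inequality (ξ a C : ℝ) :
    ¬ ∀ χ : ℝ → ℝ, ContDiff ℝ ∞ χ → HasCompactSupport χ → tsupport χ ⊆ Iic a →
      ∫ s, χ s ^ 2 ≤ C * ∫ s, (deriv (deriv χ) s ^ 2 + 4 * ξ ^ 2 * deriv χ s ^ 2) := by
  intro hC
  obtain ⟨η, hη, hηc, hηs, hpos⟩ : ∃ η : ℝ → ℝ, ContDiff ℝ ∞ η ∧ HasCompactSupport η ∧
      (∀ s, η s ≠ 0 → s ∈ Icc (-3) (-1)) ∧ 0 < ∫ s, η s ^ 2 := by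
    let β : ContDiffBump (-2 : ℝ) := ⟨1 / 2, 1, by norm_num, by norm_num⟩
    refine ⟨β, β.contDiff, β.hasCompactSupport, fun s hs => ?_, ?_⟩
    · have hmem : s ∈ Metric.ball (-2 : ℝ) 1 := β.support_eq ▸ hs
      rw [Metric.mem_ball, Real.dist_eq, abs_lt] at hmem
      exact ⟨by linarith [hmem.1], by linarith [hmem.2]⟩
    · refine Continuous.integral_pos_of_hasCompactSupport_nonneg_nonzero (x := -2)
        (β.continuous.pow 2) (β.hasCompactSupport.comp_left (g := fun t : ℝ => t ^ 2) (by simp))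
        (fun s => sq_nonneg _) ?_
      have : β (-2) = 1 := β.one_of_mem_closedBall (Metric.mem_closedBall_self (by norm_num))
      simp [this]
  have key : ∀ ε : ℝ, 0 < ε → ε * (-a) ≤ 1 → ∫ s, η s ^ 2 ≤
      C * ∫ s, (ε ^ 4 * deriv (deriv η) s ^ 2 + 4 * ξ ^ 2 * ε ^ 2 * deriv η s ^ 2) := by
    intro ε hε hεa
    have hsupp : Function.support (fun s => η (ε * s)) ⊆ Icc (-3 / ε) (-1 / ε) := by
      intro s hs
      have hmem := hηs _ (Function.mem_support.1 hs)
      rw [mem_Icc, div_le_iff₀ hε, le_div_iff₀ hε]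
      constructor <;> linarith [hmem.1, hmem.2]
    have hts : tsupport (fun s => η (ε * s)) ⊆ Icc (-3 / ε) (-1 / ε) :=
      closure_minimal hsupp isClosed_Icc
    have hle : -1 / ε ≤ a := by
      rw [div_le_iff₀ hε]
      linarith
    have h1 : deriv (fun s => η (ε * s)) = fun s => ε * deriv η (ε * s) := by
      ext s
      rw [deriv_comp_mul_left, smul_eq_mul]
    have h2 : deriv (deriv (fun s => η (ε * s))) = fun s => ε ^ 2 * deriv (deriv η) (ε * s) := by
      rw [h1]
      ext s
      rw [deriv_const_mul_field, deriv_comp_mul_left, smul_eq_mul]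
      ring
    have hcd : ContDiff ℝ ∞ fun s => η (ε * s) :=
      hη.comp (by fun_prop : ContDiff ℝ ∞ fun s => ε * s)
    have hcs : HasCompactSupport fun s => η (ε * s) :=
      HasCompactSupport.of_support_subset_isCompact isCompact_Icc hsupp
    have hineq := hC (fun s => η (ε * s)) hcd hcs
      (hts.trans fun s hs => hs.2.trans hle)
    rw [h2, h1] at hineq
    have c1 := Measure.integral_comp_mul_left (fun s => η s ^ 2) ε
    have c2 := Measure.integral_comp_mul_left (fun s =>
      ε ^ 4 * deriv (deriv η) s ^ 2 + 4 * ξ ^ 2 * ε ^ 2 * deriv η s ^ 2) ε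
    have c3 : (∫ s, ((ε ^ 2 * deriv (deriv η) (ε * s)) ^ 2 +
        4 * ξ ^ 2 * (ε * deriv η (ε * s)) ^ 2)) = ∫ s, (ε ^ 4 * deriv (deriv η) (ε * s) ^ 2 +
        4 * ξ ^ 2 * ε ^ 2 * deriv η (ε * s) ^ 2) := by
      congr 1
      ext s
      ring
    rw [c3, c1, c2, abs_of_pos (inv_pos.2 hε), smul_eq_mul, smul_eq_mul, mul_left_comm] at hineq
    exact le_of_mul_le_mul_left hineq (inv_pos.2 hε)
  have hη1 : ContDiff ℝ ∞ (deriv η) := (contDiff_infty_iff_deriv.1 hη).2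
  have hη2 : ContDiff ℝ ∞ (deriv (deriv η)) := (contDiff_infty_iff_deriv.1 hη1).2
  have int1 : Integrable fun s => deriv η s ^ 2 :=
    integrable_sq_of_hasCompactSupport hη1.continuous hηc.deriv
  have int2 : Integrable fun s => deriv (deriv η) s ^ 2 :=
    integrable_sq_of_hasCompactSupport hη2.continuous hηc.deriv.deriv
  have hlim : Tendsto (fun ε : ℝ => C * (ε ^ 4 * (∫ s, deriv (deriv η) s ^ 2) +
      4 * ξ ^ 2 * ε ^ 2 * ∫ s, deriv η s ^ 2)) (𝓝[>] 0) (𝓝 0) := by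
    have hcont : Continuous fun ε : ℝ => C * (ε ^ 4 * (∫ s, deriv (deriv η) s ^ 2) +
      4 * ξ ^ 2 * ε ^ 2 * ∫ s, deriv η s ^ 2) := by fun_prop
    simpa using (hcont.tendsto 0).mono_left nhdsWithin_le_nhds
  refine hpos.not_ge (ge_of_tendsto hlim ?_)
  have hsmall : ∀ᶠ ε : ℝ in 𝓝[>] 0, ε * (-a) < 1 :=
    (((continuous_id.mul continuous_const).tendsto' (0 : ℝ) 0 (by simp)).mono_left
      nhdsWithin_le_nhds).eventually_lt_const one_pos
  filter_upwards [hsmall, self_mem_nhdsWithin] with ε h1 h2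
  have := key ε h2 h1.le
  rwa [integral_add (int2.const_mul _) (int1.const_mul _), integral_const_mul,
    integral_const_mul] at this

/-- If the transmission problem at the vertex has a solution oscillating in `log r`, then `l` is in
the spectrum. -/
theorem mem_spectrum_of_transmission (hΩ : Bornology.IsBounded Ω) (hΩo : IsOpen Ω)
    (hDm : MeasurableSet D) (hD : D ⊆ Ω) (h : Transmission ξ γ p q κ) (hij : i ≠ j)
    (hγ : 0 < γ) (hγ' : γ < Real.pi / 2) (ha : a < 0)
    (hball : Metric.closedBall 0 (Real.exp a) ⊆ Ω)
    (hcoeff : ∀ x : Plane, ‖x‖ ≤ Real.exp a → x i ≠ 0 → x j ≠ 0 → |elevation j x| ≠ γ →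
      coeff D l x = if |elevation j x| < γ then p else q) :
    l ∈ spectrum ℝ (poincareOperator hΩ D) := by
  by_contra hl
  obtain ⟨C, hC⟩ := exists_cutoff_inequality hΩ hΩo hDm hD h hij hγ hγ' ha hball hcoeff hl
  exact not_cutoff_inequality ξ a C hC

end Cutoff

/-! ### The spectrum -/

/-- The spectrum contains every `l ∈ (0, 1)` except possibly `1/2`. For `l > 1/2` the quasi-modes
are odd in the axis `x 1 = 0` of the bowtie, for `l < 1/2` they are odd in the orthogonal axis. -/
theorem IsBowtie.mem_spectrum {Ω D : Set Plane} {α l : ℝ} (hD : IsBowtie D α)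
    (hΩ : Bornology.IsBounded Ω) (hΩo : IsOpen Ω) (h0Ω : (0 : Plane) ∈ Ω)
    (hDm : MeasurableSet D) (hDΩ : D ⊆ Ω) (hl : l ∈ Ioo 0 (1 / 2) ∪ Ioo (1 / 2) 1) :
    l ∈ spectrum ℝ (poincareOperator hΩ D) := by
  obtain ⟨r₀, hr₀, hmem⟩ := hD.exists_mem_iff
  obtain ⟨hα, hαπ, -⟩ := hD
  obtain ⟨ε, hε, hball⟩ := Metric.nhds_basis_closedBall.mem_iff.1 (hΩo.mem_nhds h0Ω)
  set a := Real.log (min ε (min (r₀ / 2) (1 / 2))) with ha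
  have hexp : Real.exp a = min ε (min (r₀ / 2) (1 / 2)) := Real.exp_log (by positivity)
  have ha0 : a < 0 := Real.log_neg (by positivity)
    (((min_le_right _ _).trans (min_le_right _ _)).trans_lt (by norm_num))
  have hballa : Metric.closedBall 0 (Real.exp a) ⊆ Ω :=
    (Metric.closedBall_subset_closedBall (hexp.le.trans (min_le_left _ _))).trans hball
  have hr : ∀ x : Plane, ‖x‖ ≤ Real.exp a → ‖x‖ < r₀ := fun x hx =>
    (hx.trans (hexp.le.trans ((min_le_right _ _).trans (min_le_left _ _)))).trans_lt (by linarith)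
  have hne : ∀ {x : Plane} {k : Fin 2}, x k ≠ 0 → x ≠ 0 := by
    rintro x k hk rfl
    simp at hk
  have hin : ∀ x ∈ D, coeff D l x = l - 1 := fun x hx => by simp [coeff, hx]
  have hout : ∀ x ∉ D, coeff D l x = l := fun x hx => by simp [coeff, hx]
  rcases hl with ⟨hl0, hl1⟩ | ⟨hl0, hl1⟩
  · have hγ : 0 < Real.pi / 2 - α / 2 := by linarith
    have hγ' : Real.pi / 2 - α / 2 < Real.pi / 2 := by linarith
    obtain ⟨ξ, κ, h⟩ := exists_transmission (a := l) (b := l - 1) hγ hγ'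
      (div_pos_of_neg_of_neg (by linarith) (by linarith))
      ((div_lt_one_of_neg (by linarith)).2 (by linarith))
    refine mem_spectrum_of_transmission hΩ hΩo hDm hDΩ h one_ne_zero hγ hγ' ha0 hballa
      fun x hxa h1 h0 hx => ?_
    obtain ⟨τ, -, -, hτ1, hτ0, -⟩ := elevation_complementary zero_ne_one h0 h1
    rw [hτ0] at hx ⊢
    have hxD := hmem x (hne h0) (hr x hxa)
    rw [hτ1] at hxD
    split_ifs with hlt
    · exact hout x fun h' => by linarith [hxD.1 h']
    · refine hin x (hxD.2 ?_)
      have := lt_of_le_of_ne (not_lt.1 hlt) (Ne.symm hx)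
      linarith
  · have hγ : 0 < α / 2 := by linarith
    have hγ' : α / 2 < Real.pi / 2 := by linarith
    obtain ⟨ξ, κ, h⟩ := exists_transmission (a := l - 1) (b := l) hγ hγ'
      (div_pos (by linarith) (by linarith)) ((div_lt_one (by linarith)).2 (by linarith))
    refine mem_spectrum_of_transmission hΩ hΩo hDm hDΩ h zero_ne_one hγ hγ' ha0 hballa
      fun x hxa h0 h1 hx => ?_
    have hxD := hmem x (hne h0) (hr x hxa)
    split_ifs with hlt
    · exact hin x (hxD.2 hlt)
    · exact hout x fun h' => hlt (hxD.1 h')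

theorem IsBowtie.isOpen {D : Set Plane} {α : ℝ} (hD : IsBowtie D α) : IsOpen D := by
  obtain ⟨-, -, _, _, _, -, h1, h2, rfl⟩ := hD
  exact h1.isOpen.union h2.isOpen

/-- A spectrum equal to `[0, 1]` has no isolated point. -/
theorem discreteSpectrum_eq_empty {H : Type*} [NormedAddCommGroup H] [InnerProductSpace ℝ H]
    {T : H →L[ℝ] H} (hT : spectrum ℝ T = Icc 0 1) : discreteSpectrum T = ∅ := by
  refine eq_empty_of_forall_notMem ?_
  rintro l ⟨hl, ⟨ε, hε, hiso⟩, -⟩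
  rw [hT] at hl hiso
  have huniq : ∀ m ∈ Icc (0 : ℝ) 1, l - ε < m → m < l + ε → m = l := fun m h1 h2 h3 => by
    have : m ∈ ({l} : Set ℝ) := hiso ▸ ⟨h1, h2, h3⟩
    exact this
  rcases hl.2.lt_or_eq with h1 | rfl
  · have hgt : l < min (l + ε / 2) 1 := lt_min (by linarith) h1
    have := huniq (min (l + ε / 2) 1) ⟨hl.1.trans hgt.le, min_le_right _ _⟩ (by linarith)
      ((min_le_left _ _).trans_lt (by linarith))
    linarith
  · have hlt : max (1 - ε / 2) 0 < 1 := max_lt (by linarith) one_pos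
    have := huniq (max (1 - ε / 2) 0) ⟨le_max_right _ _, hlt.le⟩
      ((by linarith : (1 : ℝ) - ε < 1 - ε / 2).trans_le (le_max_left _ _)) (by linarith)
    linarith

/-- The spectrum of a bounded operator on a Hilbert space is closed. -/
theorem isClosed_spectrum {H : Type*} [NormedAddCommGroup H] [InnerProductSpace ℝ H]
    [CompleteSpace H] (T : H →L[ℝ] H) : IsClosed (spectrum ℝ T) :=
  spectrum.isClosed T

theorem theorem4p1 (Ω : Set Plane) (hΩ : IsHoldAll Ω) (α : ℝ) (D : Set Plane)
    (hD : IsBowtie D α) (hDΩ : closure D ⊆ Ω) :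
    essentialSpectrum (poincareOperator hΩ.isBounded D) =
      spectrum ℝ (poincareOperator hΩ.isBounded D) ∧
    spectrum ℝ (poincareOperator hΩ.isBounded D) = Icc 0 1 := by
  have hsub : D ⊆ Ω := subset_closure.trans hDΩ
  have hspec : spectrum ℝ (poincareOperator hΩ.isBounded D) = Icc 0 1 := by
    refine (spectrum_poincareOperator_subset hΩ.isBounded hsub).antisymm ?_
    have hcl : closure (Ioo (0 : ℝ) (1 / 2) ∪ Ioo (1 / 2) 1) = Icc 0 1 := by
      rw [closure_union, closure_Ioo (by norm_num), closure_Ioo (by norm_num),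
        Icc_union_Icc_eq_Icc (by norm_num) (by norm_num)]
    rw [← hcl]
    exact closure_minimal (fun l hl => hD.mem_spectrum hΩ.isBounded hΩ.isOpen hΩ.zero_mem
      hD.isOpen.measurableSet hsub hl) (isClosed_spectrum _)
  exact ⟨by rw [essentialSpectrum, discreteSpectrum_eq_empty hspec, sdiff_empty], hspec⟩
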